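/- Let $E$ be a simple euclidean Jordan algebra, i.e. a finite-dimensional commutative, not necessarily associative, real algebra with unit $e$ satisfying $x(x^2y)=x^2(xy)$, which is nonzero, has no ideals other than $0$ and $E$, and admits an inner product for which all multiplication operators $L(x)y=xy$ are symmetric. An idempotent is primitive if it is nonzero and not a sum of two nonzero idempotents. A Jordan frame is a family $c_1,\dots,c_r$ of primitive idempotents with $c_ic_j=0$ for $i\neq j$ and $c_1+\cdots+c_r=e$. Fix a Jordan frame $c_1,\dots,c_r$ of $E$ (so $r$ is the rank of $E$). Every $x\in E$ can be written as $x=\sum_{j=1}^r x_j\tilde c_j$ with real $x_j$ and a Jordan frame $(\tilde c_j)$; the spectral values $x_j$ are unique up to order. Put $\operatorname{rank} x=\#\{j: x_j\neq 0\}$ and $\operatorname{ind}(x)=\sum_j \operatorname{sgn}(x_j)$. Let $E^\times$ be the set of invertible elements of $E$ (those $x$ for which there is $y$ in the unital subalgebra $\mathbb R[x]$ with $xy=e$), $E^\times_j=\{x\in E^\times:\operatorname{ind}(x)=j\}$, $\operatorname{Aut}(E)$ the group of algebra automorphisms of $E$, and $C=\{x^2:x\in E\}$. For $0\le k\le r$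 let $$h_k=L(c_1+\cdots+c_k)-L(c_{k+1}+\cdots+c_r),\qquad W(h_k)=C_+^0+ C_-^0+ E_0(h_k),$$ where $E_\lambda(h_k)=\ker(h_k-\lambda\,\mathrm{id})$, and $C_\pm^0$ is the interior of $C_\pm=\pm C\cap E_{\pm1}(h_k)$ in $E_{\pm1}(h_k)$. Every $v\in E$ has a unique (canonical) decomposition $v=v_+-v_-$ with $v_\pm\in C$ and $v_+v_-=0$, and for every $v \in E$ the following hold. (a) $\operatorname{Aut}(E)v\subseteq E\setminus W(h_k)$ if and only if $\operatorname{rank}v_+<k$ or $\operatorname{rank}v_-<r-k$. (b) The following are equivalent: (i) $\operatorname{Aut}(E)v\cap W(h_k)\neq\emptyset$; (ii) $\operatorname{rank}v_+=k$ and $\operatorname{rank}v_-=r-k$; (iii) $v$ is invertible and $\operatorname{ind}(v)=2k-r$. (c) In particular, $W(h_k)\subseteq E^\times_{2k-r}$. -/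

import Mathlib

open scoped Pointwise

noncomputable section

/-! Throughout, a real unital Jordan algebra is a commutative, unital, not necessarily associative
real algebra `E` (`NonAssocCommRing`, `Module ℝ E` with bilinear product) that satisfies the Jordan
identity (`IsCommJordan`). -/

namespace JordanAlg

section Algebra

variable (E : Type*) [NonAssocCommRing E] [Module ℝ E] [SMulCommClass ℝ E E] [IsScalarTower ℝ E E]

/-- There is an inner product on `E` for which every multiplication operator `L(x)` is symmetric. -/
def IsEuclidean : Prop :=
  ∃ B : LinearMap.BilinForm ℝ E,
    (∀ x y, B x y = B y x) ∧ (∀ x, x ≠ 0 → 0 < B x x) ∧ ∀ x y z, B (x * y) z = B y (x * z)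

/-- `E` is nonzero and its only ideals are `0` and `E`. -/
def IsSimpleAlg : Prop :=
  Nontrivial E ∧
    ∀ I : Submodule ℝ E, (∀ x : E, ∀ y ∈ I, x * y ∈ I) → I = ⊥ ∨ I = ⊤

/-- The group `Aut(E)` of algebra automorphisms (they fix the unit automatically). -/
def aut : Subgroup (E ≃ₗ[ℝ] E) where
  carrier := {g | ∀ x y, g (x * y) = g x * g y}
  one_mem' := fun _ _ => rfl
  mul_mem' := by
    intro g h hg hh x y
    change g (h (x * y)) = g (h x) * g (h y)
    rw [hh x y, hg]
  inv_mem' := by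
    intro g hg x y
    apply g.injective
    have h (z : E) : g (g⁻¹ z) = z := g.apply_symm_apply z
    rw [hg, h, h, h]

/-- The cone `C` of squares. -/
def cone : Set E := {x | ∃ y : E, x = y * y}

variable {E}

/-- A nonzero idempotent that is not a sum of two nonzero idempotents. -/
def IsPrimitiveIdempotent (c : E) : Prop :=
  c * c = c ∧ c ≠ 0 ∧ ∀ a b : E, a * a = a → b * b = b → c = a + b → a = 0 ∨ b = 0

/-- `c₁, …, c_r` is a Jordan frame; the number `r` is the rank of `E`. -/
def IsJordanFrame {r : ℕ} (c : Fin r → E) : Prop :=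
  (∀ i, IsPrimitiveIdempotent (c i)) ∧ (∀ i j, i ≠ j → c i * c j = 0) ∧ ∑ i, c i = 1

/-- `x = ∑ i, a i • c i` for some Jordan frame `c`, and `m` is the multiset of the `a i`. -/
def HasSpectralValues (x : E) (m : Multiset ℝ) : Prop :=
  ∃ (r : ℕ) (c : Fin r → E) (a : Fin r → ℝ),
    IsJordanFrame c ∧ x = ∑ i, a i • c i ∧ m = Finset.univ.val.map a

open Classical in
/-- The spectral values of `x`, with multiplicity. In a euclidean Jordan algebra the
multiset in question exists and is unique. -/
def spectralValues (x : E) : Multiset ℝ :=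
  if h : ∃ m, HasSpectralValues x m then h.choose else 0

/-- The rank of `x`: the number of nonzero spectral values, with multiplicity. -/
def rank (x : E) : ℕ := ((spectralValues x).filter (fun a => a ≠ 0)).card

/-- The index of `x`: the sum of the signs of its spectral values. -/
def index (x : E) : ℤ := ((spectralValues x).map (fun a => (SignType.sign a : ℤ))).sum

/-- `x` is invertible: it has an inverse in the unital subalgebra `ℝ[x]` generated by `x`. -/
def IsInvertible (x : E) : Prop :=
  ∃ y ∈ NonUnitalAlgebra.adjoin ℝ ({1, x} : Set E), x * y = 1

variable (E) in
/-- The set `E^×_j` of the invertible elements of index `j`. -/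
def invertibleOfIndex (j : ℤ) : Set E := {x | IsInvertible x ∧ index x = j}

/-- `v = p - m` is the canonical decomposition of `v` into positive part `p` and negative
part `m`. -/
def IsCanonicalDecomposition (v p m : E) : Prop :=
  p ∈ cone E ∧ m ∈ cone E ∧ p * m = 0 ∧ v = p - m

/-- `h_k = L(c₁ + ⋯ + c_k) - L(c_{k+1} + ⋯ + c_r)`. -/
def hOp {r : ℕ} (c : Fin r → E) (k : ℕ) : Module.End ℝ E :=
  LinearMap.mulLeft ℝ (∑ i with i.val < k, c i) - LinearMap.mulLeft ℝ (∑ i with k ≤ i.val, c i)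

end Algebra

section Wedge

variable {E : Type*} [NonAssocCommRing E] [Module ℝ E] [SMulCommClass ℝ E E]
  [IsScalarTower ℝ E E] [TopologicalSpace E]

/-- The interior of `S ∩ V`, taken in the subspace `V`. -/
def interiorIn (V : Submodule ℝ E) (S : Set E) : Set E :=
  ((↑) : V → E) '' interior (((↑) : V → E) ⁻¹' S)

/-- The wedge `W(h) = C₊⁰ + C₋⁰ + E₀(h)`, where `C₊ = C ∩ E₁(h)`, `C₋ = -C ∩ E₋₁(h)` and the
interiors are taken in `E₁(h)` and `E₋₁(h)`. -/
def wedge (h : Module.End ℝ E) : Set E :=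
  interiorIn (h.eigenspace 1) (cone E) + interiorIn (h.eigenspace (-1)) (-cone E) +
    (h.eigenspace 0 : Set E)

end Wedge

end JordanAlg

end

set_option linter.unusedSectionVars false

/-! Everything is reduced to counting signs of spectral values. Write $v=\sum a_i d_i$ in a Jordan
frame; then $v_\pm=\sum\max(\pm a_i,0)d_i$, so the ranks of $v_\pm$ count the positive and negative
$a_i$. The theorem follows once the orbit of $v$ is shown to meet $W(h_k)$ exactly when there are
$k$ positive and $r-k$ negative $a_i$.

If the signs fit, an automorphism carries the frame $d$ to $c$ with the positive coefficients on
$c_1,\dots,c_k$ (`exists_aut_perm_frame`, `exists_aut_of_perm`), and the image is visibly in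
$C_+^0+C_-^0$. Conversely let $v=p+m+w\in W(h_k)$ have fewer than $k$ positive $a_i$. Some primitive
$z$ annihilates $c_{k+1},\dots,c_r$ and all $d_i$ with $a_i>0$, because these are fewer than $r$
primitive idempotents (`exists_primitive_annihilator`). Then $z\in E_1(h_k)$, so $B(z,v)=B(z,p)>0$
as $p$ is interior, whereas $B(z,v)=\sum a_iB(z,d_i)\le 0$. The negative part is symmetric, and the
two bounds add up to $r$.

The structure theory behind this is built up from the Jordan identity: Peirce decomposition, power
associativity, spectral theorem, and automorphisms obtained as reflections $2L(s)^2-\mathrm{id}$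
with $s^2=1$. Two non-orthogonal primitive idempotents are exchanged by such a reflection;
simplicity supplies the reflections permuting a frame. Hence all primitive idempotents have the same
value $t>0$ of $\operatorname{tr}L$, which makes spectral values unique and serves as a dimension
count. -/

namespace JordanAlg

variable {E : Type*} [NonAssocCommRing E] [Module ℝ E] [SMulCommClass ℝ E E] [IsScalarTower ℝ E E]
  [IsCommJordan E]

/-! ### Peirce decomposition with respect to an idempotent. -/

section Peirce

attribute [local instance 100] LieRing.ofAssociativeRing

theorem linearized_jordan (a b c w : E) :
    a * (b * c * w) - b * c * (a * w) + (b * (c * a * w) - c * a * (b * w)) +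
      (c * (a * b * w) - a * b * (c * w)) = 0 := by
  have h : (2 : ℕ) • (a * (b * c * w) - b * c * (a * w) + (b * (c * a * w) - c * a * (b * w)) +
      (c * (a * b * w) - a * b * (c * w))) = 0 :=
    DFunLike.congr_fun (two_nsmul_lie_lmul_lmul_add_add_eq_zero a b c) w
  have h2 : (2 : ℝ)⁻¹ • ((2 : ℕ) • (a * (b * c * w) - b * c * (a * w) +
      (b * (c * a * w) - c * a * (b * w)) + (c * (a * b * w) - a * b * (c * w)))) = 0 := by
    rw [h, smul_zero]
  rw [← h2]
  module

variable {c : E}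

/-- The hypothesis on `z` says that its Peirce component for $1/2$ vanishes. The linearized identity
at $(c,c,x)$ reads $2[L(c),L(cx)]=[L(c),L(x)]$; with $x=cz=c(cz)$ it gives $[L(c),L(cz)]=0$, and
then $x=z$ gives $[L(c),L(z)]=0$. -/
theorem mul_left_comm_of_even (hc : c * c = c) {z : E} (hz : c * (c * z) = c * z) (w : E) :
    c * (z * w) = z * (c * w) := by
  have h1 := linearized_jordan c c (c * z) w
  have h2 := linearized_jordan c c z w
  rw [mul_comm (c * z) c, hz, hc] at h1
  rw [mul_comm z c, hc] at h2
  have h3 : c * (z * w) - z * (c * w) = -(c * (c * z * w) - c * z * (c * w) +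
    (c * (c * z * w) - c * z * (c * w)) + (z * (c * w) - c * (z * w))) +
    (2 : ℝ) • (c * (c * z * w) - c * z * (c * w) + (c * (c * z * w) - c * z * (c * w)) +
      (c * z * (c * w) - c * (c * z * w))) := by module
  rw [h1, h2] at h3
  simpa [sub_eq_zero] using h3

/-- This is $2L(c)^3-3L(c)^2+L(c)=0$, which confines the eigenvalues of $L(c)$ to $0,1/2,1$. -/
theorem peirce_cubic (hc : c * c = c) (x : E) :
    (2 : ℝ) • (c * (c * (c * x))) = (3 : ℝ) • (c * (c * x)) - c * x := by
  have h := linearized_jordan c c x c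
  rw [mul_comm x c, mul_comm (c * x) c, hc, hc, mul_comm (c * x) c, mul_comm x c] at h
  rw [← sub_eq_zero, ← h]
  module

theorem even_mul_even (hc : c * c = c) {x y : E} (hx : c * (c * x) = c * x)
    (hy : c * (c * y) = c * y) : c * (c * (x * y)) = c * (x * y) := by
  rw [mul_left_comm_of_even hc hx, mul_left_comm_of_even hc hx, hy]

theorem half_mul_half (hc : c * c = c) {x y : E} (hx : c * x = (1 / 2 : ℝ) • x)
    (hy : c * y = (1 / 2 : ℝ) • y) : c * (c * (x * y)) = c * (x * y) := by
  have h := linearized_jordan c x y c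
  rw [hc, mul_comm y c, mul_comm x c, hx, hy, mul_comm (x * y) c] at h
  simp only [smul_mul_assoc, mul_smul_comm] at h
  rw [mul_comm y c, mul_comm x c, hx, hy] at h
  simp only [mul_smul_comm] at h
  rw [← sub_eq_zero, ← h, mul_comm y x]
  module

theorem even_mul_half (hc : c * c = c) {x y : E} (hx : c * (c * x) = c * x)
    (hy : c * y = (1 / 2 : ℝ) • y) : c * (x * y) = (1 / 2 : ℝ) • (x * y) := by
  rw [mul_left_comm_of_even hc hx, hy, mul_smul_comm]

theorem one_mul_zero (hc : c * c = c) {x y : E} (hx : c * x = x) (hy : c * y = 0) :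
    x * y = 0 := by
  have h1 := mul_left_comm_of_even hc (z := y) (by rw [hy, mul_zero]) x
  have h2 := mul_left_comm_of_even hc (z := x) (by rw [hx, hx]) y
  rw [hy, mul_zero, mul_comm x y, h1, hx, mul_comm] at h2
  exact h2

theorem one_mul_one (hc : c * c = c) {x y : E} (hx : c * x = x) (hy : c * y = y) :
    c * (x * y) = x * y := by
  rw [mul_left_comm_of_even hc (by rw [hx, hx]), hy]

/-- On $E_{1/2}(c)$ the map $z\mapsto 2L(z)$ from $E_0(c)$ respects squares. It is used to see that
a product $zw$ of off-diagonal elements does not vanish. -/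
theorem sq_mul_half (hc : c * c = c) {z w : E} (hz : c * z = 0) (hw : c * w = (1 / 2 : ℝ) • w) :
    z * z * w = (2 : ℝ) • (z * (z * w)) := by
  have hz' : c * (c * z) = c * z := by rw [hz, mul_zero]
  have h := linearized_jordan z z w c
  have h1 : z * w * c = (1 / 2 : ℝ) • (z * w) := by
    rw [mul_comm, even_mul_half hc hz' hw]
  have h2 : z * z * c = 0 := by rw [mul_comm, mul_left_comm_of_even hc hz', hz, mul_zero]
  rw [mul_comm w z, h1, h2, mul_comm z c, hz, mul_comm w c, hw] at h
  simp only [mul_zero, mul_smul_comm] at h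
  have h3 : z * z * w - (2 : ℝ) • (z * (z * w)) = (-2 : ℝ) • (0 : E) := by
    rw [← h]; module
  simpa [sub_eq_zero] using h3

/-- The Peirce component of `x` for the eigenvalue `1`. -/
def peirceOne (c x : E) : E := (2 : ℝ) • (c * (c * x)) - c * x

/-- The Peirce component of `x` for the eigenvalue `1 / 2`. -/
def peirceHalf (c x : E) : E := (4 : ℝ) • (c * x - c * (c * x))

theorem mul_peirceOne (hc : c * c = c) (x : E) : c * peirceOne c x = peirceOne c x := by
  have h := peirce_cubic hc x
  simp only [peirceOne, mul_sub, mul_smul_comm, h]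
  module

theorem mul_peirceHalf (hc : c * c = c) (x : E) :
    c * peirceHalf c x = (1 / 2 : ℝ) • peirceHalf c x := by
  have h := peirce_cubic hc x
  have h' : c * (c * (c * x)) = (3 / 2 : ℝ) • (c * (c * x)) - (1 / 2 : ℝ) • (c * x) := by
    rw [show c * (c * (c * x)) = (1 / 2 : ℝ) • ((2 : ℝ) • (c * (c * (c * x)))) by module, h]
    module
  simp only [peirceHalf, mul_sub, mul_smul_comm, h']
  module

theorem even_sub_peirceHalf (hc : c * c = c) (x : E) :
    c * (c * (x - peirceHalf c x)) = c * (x - peirceHalf c x) := by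
  simp only [mul_sub, mul_peirceHalf hc, mul_smul_comm]
  simp only [peirceHalf]
  module

end Peirce

/-! ### Automorphisms from square roots of the unit. -/

section Reflection

/-- With $s=2c-1$, $c$ is idempotent and the map is $+1$ on $E_1(c)+E_0(c)$ and $-1$ on
$E_{1/2}(c)$. The Peirce rules make this splitting a $\mathbb Z/2$-grading, so the map is
multiplicative. -/
theorem exists_aut_of_sq_eq_one {s : E} (hs : s * s = 1) :
    ∃ g ∈ aut E, ∀ x, g x = (2 : ℝ) • (s * (s * x)) - x := by
  let P : E →ₗ[ℝ] E := (2 : ℝ) • (LinearMap.mulLeft ℝ s ∘ₗ LinearMap.mulLeft ℝ s) - LinearMap.id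
  have hP (x) : P x = (2 : ℝ) • (s * (s * x)) - x := rfl
  obtain ⟨c, rfl⟩ : ∃ c : E, s = (2 : ℝ) • c - 1 := ⟨(1 / 2 : ℝ) • (1 + s), by module⟩
  have hc : c * c = c := by
    have h : c * c - c = (1 / 4 : ℝ) • (((2 : ℝ) • c - 1) * ((2 : ℝ) • c - 1) - 1) := by
      simp only [mul_sub, sub_mul, mul_smul_comm, smul_mul_assoc, mul_one, one_mul]
      module
    rwa [hs, sub_self, smul_zero, sub_eq_zero] at h
  have hP' (x) : P x = (8 : ℝ) • (c * (c * x)) - (8 : ℝ) • (c * x) + x := by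
    rw [hP]
    simp only [mul_sub, sub_mul, mul_smul_comm, smul_mul_assoc, one_mul]
    module
  have heven {x : E} (hx : c * (c * x) = c * x) : P x = x := by rw [hP', hx]; module
  have hhalf {x : E} (hx : c * x = (1 / 2 : ℝ) • x) : P x = -x := by
    rw [hP', hx, mul_smul_comm, hx]; module
  have hdec (x : E) : ∃ y z, c * (c * y) = c * y ∧ c * z = (1 / 2 : ℝ) • z ∧ x = y + z :=
    ⟨_, _, even_sub_peirceHalf hc x, mul_peirceHalf hc x, by abel⟩
  have hinv : Function.Involutive P := by
    intro x
    obtain ⟨y, z, hy, hz, rfl⟩ := hdec x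
    simp only [map_add, heven hy, hhalf hz, map_neg, neg_neg]
  refine ⟨LinearEquiv.ofInvolutive P hinv, ?_, hP⟩
  intro x x'
  change P (x * x') = P x * P x'
  obtain ⟨y, z, hy, hz, rfl⟩ := hdec x
  obtain ⟨y', z', hy', hz', rfl⟩ := hdec x'
  simp only [add_mul, mul_add, map_add, heven hy, hhalf hz, heven hy', hhalf hz',
    heven (even_mul_even hc hy hy'), heven (half_mul_half hc hz hz'),
    hhalf (even_mul_half hc hy hz'), mul_neg, neg_mul]
  rw [mul_comm z y', hhalf (even_mul_half hc hy' hz)]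
  abel

end Reflection

/-! ### Power associativity. -/

section PowerAssociative

open Polynomial

local notation "L" => LinearMap.mulLeft ℝ

/-- Powers are taken as $L(x)^n1$. The linearized identity `e3` expresses $L(x^2w)$ through $L(x)$,
$L(x^2)$, $L(w)$ and $L(xw)$, hence an induction with two predecessors. -/
theorem commute_mulLeft_pow (x : E) (n : ℕ) :
    Commute (L ((L x ^ n) 1)) (L x) ∧ Commute (L ((L x ^ n) 1)) (L (x * x)) := by
  have hx : Commute (L x) (L (x * x)) := by
    refine LinearMap.ext fun y => ?_
    simpa [mul_comm] using (IsCommJordan.lmul_comm_rmul_rmul x y).symm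
  induction n using Nat.twoStepInduction with
  | zero => simp [← Module.End.one_eq_id, Commute.one_left]
  | one => simpa using hx
  | more n h0 h1 =>
    set w := (L x ^ n) 1 with hw
    have e1 : (L x ^ (n + 1)) 1 = x * w := by
      rw [pow_succ', Module.End.mul_apply, LinearMap.mulLeft_apply]
    have e2 : (L x ^ (n + 2)) 1 = x * x * w := by
      have h : (L x ^ n * L (x * x)) 1 = (L (x * x) * L x ^ n) 1 := by
        rw [(hx.pow_left n).eq]
      rw [pow_add, Module.End.mul_apply]
      simpa [pow_two] using h
    have e3 : L (x * x * w) =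
        L (x * x) * L w - (2 : ℝ) • (L x * L w * L x) + (2 : ℝ) • (L (x * w) * L x) := by
      refine LinearMap.ext fun z => ?_
      have h := linearized_jordan x x z w
      simp only [LinearMap.add_apply, LinearMap.sub_apply, LinearMap.smul_apply,
        Module.End.mul_apply, LinearMap.mulLeft_apply]
      rw [mul_comm z x, mul_comm (x * z) w, mul_comm (x * z) (x * w), mul_comm z (x * x * w),
        mul_comm z w] at h
      rw [← sub_eq_zero, ← h]
      module
    rw [e1] at h1
    rw [e2, e3]
    have hxx : Commute (L x) (L x) := Commute.refl _
    exact ⟨((hx.symm.mul_left h0.1).sub_left (((hxx.mul_left h0.1).mul_left hxx).smul_left _)).add_left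
      ((h1.1.mul_left hxx).smul_left _),
      (((Commute.refl _).mul_left h0.2).sub_left (((hx.mul_left h0.2).mul_left hx).smul_left _)).add_left
      ((h1.2.mul_left hx).smul_left _)⟩

theorem commute_mulLeft_aeval (x : E) (p : ℝ[X]) : Commute (L (aeval (L x) p 1)) (L x) := by
  induction p using Polynomial.induction_on' with
  | add p q hp hq =>
    have h : L (aeval (L x) (p + q) 1) = L (aeval (L x) p 1) + L (aeval (L x) q 1) := by
      refine LinearMap.ext fun y => ?_
      simp [add_mul]
    rw [h]
    exact hp.add_left hq
  | monomial n a =>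
    have h : L (aeval (L x) (monomial n a) 1) = a • L ((L x ^ n) 1) := by
      refine LinearMap.ext fun y => ?_
      simp [aeval_monomial, smul_mul_assoc]
    rw [h]
    exact (commute_mulLeft_pow x n).1.smul_left _

/-- Here $p(L(x))1$ plays the role of $p(x)$; multiplicativity in $p$ is the associativity of
$\mathbb R[x]$. -/
theorem aeval_mul_aeval (x : E) (p q : ℝ[X]) :
    aeval (L x) p 1 * aeval (L x) q 1 = aeval (L x) (p * q) 1 := by
  have h : Commute (L (aeval (L x) p 1)) (aeval (L x) q) := by
    induction q using Polynomial.induction_on' with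
    | add q r hq hr => rw [map_add]; exact hq.add_right hr
    | monomial n a =>
      rw [aeval_monomial]
      exact (Algebra.commute_algebraMap_right a _).mul_right ((commute_mulLeft_aeval x p).pow_right n)
  have h' := LinearMap.congr_fun h.eq 1
  rw [Module.End.mul_apply, Module.End.mul_apply, LinearMap.mulLeft_apply, LinearMap.mulLeft_apply,
    mul_one] at h'
  rw [h', mul_comm p q, map_mul, Module.End.mul_apply]

end PowerAssociative

/-- A positive definite symmetric bilinear form for which all multiplications are symmetric. -/
structure IsEuclideanForm (B : LinearMap.BilinForm ℝ E) : Prop where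
  symm : ∀ x y, B x y = B y x
  pos : ∀ x, x ≠ 0 → 0 < B x x
  assoc : ∀ x y z, B (x * y) z = B y (x * z)

/-! ### Positivity of the form against idempotents. -/

section Form

variable {B : LinearMap.BilinForm ℝ E}

theorem IsEuclideanForm.nonneg (hB : IsEuclideanForm B) (x : E) : 0 ≤ B x x := by
  by_cases hx : x = 0
  · simp [hx]
  · exact (hB.pos x hx).le

theorem IsEuclideanForm.eq_zero (hB : IsEuclideanForm B) {x : E} (hx : B x x ≤ 0) : x = 0 := by
  by_contra h
  exact (hB.pos x h).not_ge hx

/-- Peirce components are orthogonal, so $B(c,y^2)=B(cy,y)$ becomes a sum of squares. This yields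
both $B(c,y^2)\ge0$ and the consequence of equality, $cy=0$. -/
theorem IsEuclideanForm.form_sq (hB : IsEuclideanForm B) {c : E} (hc : c * c = c) (y : E) :
    ∃ e h : E, y = e + h ∧ c * (c * e) = c * e ∧ c * h = (1 / 2 : ℝ) • h ∧
      B c (y * y) = B (c * e) (c * e) + 1 / 2 * B h h := by
  refine ⟨_, _, ?_, even_sub_peirceHalf hc y, mul_peirceHalf hc y, ?_⟩
  · abel
  set h := peirceHalf c y with hh
  set e := y - h with he
  have hce : c * (c * e) = c * e := even_sub_peirceHalf hc y
  have hch : c * h = (1 / 2 : ℝ) • h := mul_peirceHalf hc y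
  have h1 : B c (y * y) = B (c * y) y := by rw [← hB.assoc, mul_comm]
  have h2 : B (c * e) h = 0 := by
    have h3 := hB.assoc c (c * e) h
    rw [hce, hch, map_smul, smul_eq_mul] at h3
    linarith
  have h4 : B h e = 0 := by
    have h3 := hB.assoc c h e
    rw [hch, map_smul, LinearMap.smul_apply, smul_eq_mul, hB.symm h (c * e), h2] at h3
    linarith
  have h5 : B (c * e) e = B (c * e) (c * e) := by rw [← hB.assoc, hce]
  have hy : y = e + h := by rw [he]; abel
  rw [h1, hy, mul_add, hch]
  simp only [map_add, LinearMap.add_apply, map_smul, LinearMap.smul_apply, smul_eq_mul, h2, h4, h5]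
  ring

theorem IsEuclideanForm.form_sq_nonneg (hB : IsEuclideanForm B) {c : E} (hc : c * c = c) (y : E) :
    0 ≤ B c (y * y) := by
  obtain ⟨e, h, -, -, -, h1⟩ := hB.form_sq hc y
  have h2 := hB.nonneg (c * e)
  have h3 := hB.nonneg h
  linarith

theorem IsEuclideanForm.mul_eq_zero_of_form_sq (hB : IsEuclideanForm B) {c y : E} (hc : c * c = c)
    (hy : B c (y * y) = 0) : c * y = 0 := by
  obtain ⟨e, h, rfl, -, h4, h1⟩ := hB.form_sq hc y
  have h2 := hB.nonneg (c * e)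
  have h3 := hB.nonneg h
  rw [mul_add, h4, hB.eq_zero (x := c * e) (by linarith), hB.eq_zero (x := h) (by linarith),
    smul_zero, add_zero]

theorem IsEuclideanForm.form_idem_nonneg (hB : IsEuclideanForm B) {c d : E} (hc : c * c = c)
    (hd : d * d = d) : 0 ≤ B c d := by
  have h := hB.form_sq_nonneg hc d
  rwa [hd] at h

theorem IsEuclideanForm.mul_eq_zero_of_form_idem (hB : IsEuclideanForm B) {c d : E}
    (hc : c * c = c) (hd : d * d = d) (h : B c d = 0) : c * d = 0 :=
  hB.mul_eq_zero_of_form_sq hc (by rwa [hd])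

theorem IsEuclideanForm.form_eq_zero (hB : IsEuclideanForm B) {x y : E} (h : x * y = 0) :
    B x y = 0 := by
  rw [← mul_one x, hB.assoc, h, map_zero]

end Form

/-! ### Orthogonal families of idempotents. -/

section Family

variable {ι : Type*} {c : ι → E} {S : Finset ι}

theorem mul_sum_smul_of_orthogonal (hc : ∀ i ∈ S, c i * c i = c i)
    (ho : ∀ i ∈ S, ∀ j ∈ S, i ≠ j → c i * c j = 0) (a : ι → ℝ) {i : ι} (hi : i ∈ S) :
    c i * ∑ j ∈ S, a j • c j = a i • c i := by
  rw [Finset.mul_sum, Finset.sum_eq_single_of_mem i hi, mul_smul_comm, hc i hi]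
  intro j hj hji
  rw [mul_smul_comm, ho i hi j hj hji.symm, smul_zero]

theorem sum_smul_mul_sum_smul_of_orthogonal (hc : ∀ i ∈ S, c i * c i = c i)
    (ho : ∀ i ∈ S, ∀ j ∈ S, i ≠ j → c i * c j = 0) (a b : ι → ℝ) :
    (∑ j ∈ S, a j • c j) * ∑ j ∈ S, b j • c j = ∑ j ∈ S, (a j * b j) • c j := by
  rw [Finset.sum_mul]
  refine Finset.sum_congr rfl fun i hi => ?_
  rw [smul_mul_assoc, mul_sum_smul_of_orthogonal hc ho b hi, smul_smul]

/-- From $gx=0$ follows $0=B(g,x^2)=\sum a_j^2B(g,c_j)$ with nonnegative terms. Applied to $g=1-e$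
it turns $ex=x$ into $ec_i=c_i$. -/
theorem IsEuclideanForm.mul_eq_zero_of_mul_sum_eq_zero {B : LinearMap.BilinForm ℝ E}
    (hB : IsEuclideanForm B) (hc : ∀ i ∈ S, c i * c i = c i)
    (ho : ∀ i ∈ S, ∀ j ∈ S, i ≠ j → c i * c j = 0) (a : ι → ℝ) {g : E} (hg : g * g = g)
    (h : g * ∑ j ∈ S, a j • c j = 0) {i : ι} (hi : i ∈ S) (hai : a i ≠ 0) : g * c i = 0 := by
  set x := ∑ j ∈ S, a j • c j with hx
  have h1 : B g (x * x) = 0 := by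
    rw [← hB.assoc, mul_comm, h, map_zero, LinearMap.zero_apply]
  rw [hx, sum_smul_mul_sum_smul_of_orthogonal hc ho, map_sum] at h1
  simp only [map_smul, smul_eq_mul] at h1
  have h2 : ∀ j ∈ S, 0 ≤ a j * a j * B g (c j) := fun j hj =>
    mul_nonneg (mul_self_nonneg _) (hB.form_idem_nonneg hg (hc j hj))
  have h3 := (Finset.sum_eq_zero_iff_of_nonneg h2).1 h1 i hi
  exact hB.mul_eq_zero_of_form_idem hg (hc i hi)
    ((mul_eq_zero.1 h3).resolve_left (mul_self_ne_zero.2 hai))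

end Family

/-! ### Spectral theorem and existence of Jordan frames. -/

section Spectral

open Polynomial

theorem iSup_eigenspace_eq_top_of_form {V : Type*} [AddCommGroup V] [Module ℝ V]
    [FiniteDimensional ℝ V] (B : LinearMap.BilinForm ℝ V) (hsymm : ∀ x y, B x y = B y x)
    (hpos : ∀ x, x ≠ 0 → 0 < B x x) (T : Module.End ℝ V) (hT : ∀ x y, B (T x) y = B x (T y)) :
    ⨆ μ, T.eigenspace μ = ⊤ := by
  let core : InnerProductSpace.Core ℝ V :=
    { inner := fun x y => B x y
      conj_inner_symm := fun x y => by simp [hsymm x y]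
      re_inner_nonneg := fun x => by
        by_cases hx : x = 0
        · simp [hx]
        · exact (hpos x hx).le
      add_left := fun x y z => by simp
      smul_left := fun x y r => by simp
      definite := fun x hx => by
        by_contra h
        exact (hpos x h).ne' hx }
  let _ : NormedAddCommGroup V := core.toNormedAddCommGroup
  let _ : InnerProductSpace ℝ V := InnerProductSpace.ofCore core.toCore
  have h : T.IsSymmetric := hT
  exact (Submodule.orthogonal_eq_bot_iff).1 h.orthogonalComplement_iSup_eigenspaces_eq_bot

variable [FiniteDimensional ℝ E] {B : LinearMap.BilinForm ℝ E}

/-- The idempotents are the components of $1$ in the eigenspaces of the symmetric operator $L(x)$. A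
Lagrange polynomial $p_\mu$ gives $f_\mu=p_\mu(L(x))1$, and power associativity turns $f_\mu f_\nu$
into $p_\mu(\nu)f_\nu$. -/
theorem IsEuclideanForm.exists_idempotent_decomposition (hB : IsEuclideanForm B) (x : E) :
    ∃ (S : Finset ℝ) (e : ℝ → E), (∀ μ ∈ S, e μ * e μ = e μ) ∧ (∀ μ ∈ S, e μ ≠ 0) ∧
      (∀ μ ∈ S, ∀ ν ∈ S, μ ≠ ν → e μ * e ν = 0) ∧ ∑ μ ∈ S, e μ = 1 ∧
      x = ∑ μ ∈ S, μ • e μ := by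
  set T : Module.End ℝ E := LinearMap.mulLeft ℝ x with hT
  have htop := iSup_eigenspace_eq_top_of_form B hB.symm hB.pos T fun y z => hB.assoc x y z
  have h1 : (1 : E) ∈ ⨆ μ, T.eigenspace μ := htop ▸ Submodule.mem_top
  obtain ⟨f, hf, hsum⟩ := (Submodule.mem_iSup_iff_exists_finsupp _ _).1 h1
  have hev (p : ℝ[X]) (μ : ℝ) : aeval T p (f μ) = p.eval μ • f μ := by
    by_cases h0 : f μ = 0
    · simp [h0]
    · exact Module.End.aeval_apply_of_hasEigenvector ⟨hf μ, h0⟩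
  have hp (μ : ℝ) (hμ : μ ∈ f.support) :
      aeval T (Lagrange.basis f.support id μ) 1 = f μ := by
    rw [← hsum, Finsupp.sum, map_sum, Finset.sum_eq_single_of_mem μ hμ]
    · rw [hev]
      have := Lagrange.eval_basis_self (s := f.support) (v := (id : ℝ → ℝ))
        (Function.injective_id.injOn) hμ
      rw [id] at this
      rw [this, one_smul]
    · intro ν hν hne
      rw [hev]
      have := Lagrange.eval_basis_of_ne (s := f.support) (v := (id : ℝ → ℝ)) hne.symm hν
      rw [id] at this
      rw [this, zero_smul]
  have hmul (μ ν : ℝ) (hμ : μ ∈ f.support) (hν : ν ∈ f.support) :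
      f μ * f ν = (Lagrange.basis f.support id μ).eval ν • f ν := by
    rw [← hev]
    conv_lhs => rw [← hp μ hμ, ← hp ν hν]
    rw [hT, aeval_mul_aeval, map_mul, Module.End.mul_apply, ← hT, hp ν hν]
  refine ⟨f.support, f, fun μ hμ => ?_, fun μ hμ => Finsupp.mem_support_iff.1 hμ,
    fun μ hμ ν hν hne => ?_, hsum, ?_⟩
  · have := Lagrange.eval_basis_self (s := f.support) (v := (id : ℝ → ℝ))
      (Function.injective_id.injOn) hμ
    rw [id] at this
    rw [hmul μ μ hμ hμ, this, one_smul]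
  · have := Lagrange.eval_basis_of_ne (s := f.support) (v := (id : ℝ → ℝ)) hne hν
    rw [id] at this
    rw [hmul μ ν hμ hν, this, zero_smul]
  · have h2 : x = T 1 := by simp [hT]
    rw [h2, ← hsum, Finsupp.sum, map_sum]
    exact Finset.sum_congr rfl fun μ _ => Module.End.mem_eigenspace_iff.1 (hf μ)

/-- This is $E_1(c)=\mathbb Rc$: each spectral idempotent of $x$ with nonzero eigenvalue lies below
$c$, so primitivity makes it equal to $c$. -/
theorem IsEuclideanForm.eq_smul_of_primitive (hB : IsEuclideanForm B) {c x : E}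
    (hc : IsPrimitiveIdempotent c) (hx : c * x = x) : ∃ t : ℝ, x = t • c := by
  obtain ⟨S, e, he, he0, heo, hs, hxe⟩ := hB.exists_idempotent_decomposition x
  have hg : (1 - c) * (1 - c) = 1 - c := by
    simp only [mul_sub, sub_mul, mul_one, one_mul, hc.1]
    abel
  have key : ∀ μ ∈ S, μ • e μ ∈ Submodule.span ℝ {c} := by
    intro μ hμ
    by_cases h0 : μ = 0
    · simp [h0]
    have h1 : (1 - c) * e μ = 0 := by
      refine hB.mul_eq_zero_of_mul_sum_eq_zero he heo (fun μ => μ) hg ?_ hμ h0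
      rw [← hxe, sub_mul, one_mul, hx, sub_self]
    rw [sub_mul, one_mul, sub_eq_zero] at h1
    have h2 : (c - e μ) * (c - e μ) = c - e μ := by
      simp only [mul_sub, sub_mul, hc.1, ← h1, mul_comm (e μ) c, he μ hμ]
      abel
    rcases hc.2.2 (e μ) (c - e μ) (he μ hμ) h2 (by abel) with h | h
    · exact absurd h (he0 μ hμ)
    · rw [← sub_eq_zero.1 h]
      exact Submodule.smul_mem _ _ (Submodule.mem_span_singleton_self c)
  have h := Submodule.sum_mem _ key
  rw [← hxe] at h
  obtain ⟨t, ht⟩ := Submodule.mem_span_singleton.1 h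
  exact ⟨t, ht.symm⟩

open Classical in
-- Among the complete orthogonal systems of idempotents whose span contains `x`, one of maximal
-- cardinality is primitive: splitting a member would give a larger system. Linear independence
-- bounds the cardinality.
theorem IsEuclideanForm.exists_jordanFrame (hB : IsEuclideanForm B) (x : E) :
    ∃ (r : ℕ) (c : Fin r → E) (a : Fin r → ℝ), IsJordanFrame c ∧ x = ∑ i, a i • c i := by
  let P : Finset E → Prop := fun S => (∀ s ∈ S, s * s = s) ∧ (∀ s ∈ S, s ≠ 0) ∧
    (∀ s ∈ S, ∀ t ∈ S, s ≠ t → s * t = 0) ∧ ∑ s ∈ S, s = 1 ∧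
    x ∈ Submodule.span ℝ (S : Set E)
  have hcard : ∀ S, P S → S.card ≤ Module.finrank ℝ E := by
    rintro S ⟨h1, h0, h2, -, -⟩
    have hli : LinearIndependent ℝ ((↑) : S → E) := by
      rw [linearIndependent_iff']
      intro s g hg i hi
      have h3 := mul_sum_smul_of_orthogonal (S := s) (c := ((↑) : S → E)) (fun i _ => h1 i i.2)
        (fun i _ j _ hij => h2 i i.2 j j.2 fun h => hij (Subtype.ext h)) g hi
      rw [hg, mul_zero] at h3
      exact (smul_eq_zero.1 h3.symm).resolve_right (h0 i i.2)
    simpa using hli.fintype_card_le_finrank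
  have hne : ∃ S, P S := by
    obtain ⟨S, e, he, he0, heo, hs, hxe⟩ := hB.exists_idempotent_decomposition x
    have hinj : Set.InjOn e S := by
      intro μ hμ ν hν h
      by_contra hne
      have h1 := heo μ hμ ν hν hne
      rw [← h, he μ hμ] at h1
      exact he0 μ hμ h1
    refine ⟨S.image e, ?_, ?_, ?_, ?_, ?_⟩
    · simpa using he
    · simpa using he0
    · simp only [Finset.forall_mem_image]
      intro μ hμ ν hν h
      exact heo μ hμ ν hν fun h' => h (by rw [h'])
    · rw [Finset.sum_image hinj, hs]
    · rw [hxe]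
      exact Submodule.sum_mem _ fun μ hμ => Submodule.smul_mem _ _
        (Submodule.subset_span (by simpa using ⟨μ, hμ, rfl⟩))
  obtain ⟨S, hS, hmax⟩ : ∃ S, P S ∧ ∀ S', P S' → S'.card ≤ S.card := by
    let N : Set ℕ := {n | ∃ S, P S ∧ S.card = n}
    have hb : BddAbove N := ⟨Module.finrank ℝ E, by rintro n ⟨S, hS, rfl⟩; exact hcard S hS⟩
    obtain ⟨S, hS, hn⟩ := Nat.sSup_mem (s := N) (by obtain ⟨S, hS⟩ := hne; exact ⟨_, S, hS, rfl⟩) hb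
    exact ⟨S, hS, fun S' hS' => hn ▸ le_csSup hb ⟨S', hS', rfl⟩⟩
  obtain ⟨h1, h0, h2, hsum, hspan⟩ := hS
  have hprim : ∀ s ∈ S, IsPrimitiveIdempotent s := by
    intro s hs
    refine ⟨h1 s hs, h0 s hs, fun a b ha hb hab => ?_⟩
    by_contra! hcon
    obtain ⟨ha0, hb0⟩ := hcon
    have hab0 : a * b = 0 := by
      have h3 := h1 s hs
      rw [hab] at h3
      simp only [mul_add, add_mul, ha, hb, mul_comm b a] at h3
      have h4 : a * b = (1 / 2 : ℝ) • (a + a * b + (a * b + b) - (a + b)) := by module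
      rw [h4, h3, sub_self, smul_zero]
    have hsa : s * a = a := by rw [hab, add_mul, ha, mul_comm b a, hab0, add_zero]
    have hsb : s * b = b := by rw [hab, add_mul, hb, hab0, zero_add]
    have hne : a ≠ b := by
      rintro rfl
      rw [ha] at hab0
      exact ha0 hab0
    have hor : ∀ t ∈ S.erase s, a * t = 0 ∧ b * t = 0 := by
      intro t ht
      rw [Finset.mem_erase] at ht
      exact ⟨one_mul_zero (h1 s hs) hsa (h2 s hs t ht.2 ht.1.symm),
        one_mul_zero (h1 s hs) hsb (h2 s hs t ht.2 ht.1.symm)⟩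
    have hanot : a ∉ S.erase s := fun h => ha0 (by rw [← ha]; exact (hor a h).1)
    have hbnot : b ∉ S.erase s := fun h => hb0 (by rw [← hb]; exact (hor b h).2)
    have hanot' : a ∉ insert b (S.erase s) := by simp [hne, hanot]
    have hP : P (insert a (insert b (S.erase s))) := by
      refine ⟨?_, ?_, ?_, ?_, ?_⟩
      · simp only [Finset.forall_mem_insert]
        exact ⟨ha, hb, fun t ht => h1 t (Finset.mem_of_mem_erase ht)⟩
      · simp only [Finset.forall_mem_insert]
        exact ⟨ha0, hb0, fun t ht => h0 t (Finset.mem_of_mem_erase ht)⟩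
      · simp only [Finset.forall_mem_insert]
        refine ⟨⟨by simp, fun _ => hab0, fun t ht _ => (hor t ht).1⟩,
          ⟨fun _ => by rw [mul_comm, hab0], by simp, fun t ht _ => (hor t ht).2⟩,
          fun t ht => ⟨fun _ => by rw [mul_comm, (hor t ht).1],
            fun _ => by rw [mul_comm, (hor t ht).2], fun u hu =>
            h2 t (Finset.mem_of_mem_erase ht) u (Finset.mem_of_mem_erase hu)⟩⟩
      · rw [Finset.sum_insert hanot', Finset.sum_insert hbnot, ← add_assoc, ← hab,
          Finset.add_sum_erase S (fun s => s) hs, hsum]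
      · refine (Submodule.span_le.2 ?_ : Submodule.span ℝ (S : Set E) ≤ _) hspan
        intro t ht
        by_cases hts : t = s
        · rw [hts, hab]
          exact Submodule.add_mem _ (Submodule.subset_span (by simp))
            (Submodule.subset_span (by simp))
        · refine Submodule.subset_span ?_
          have : t ∈ S := ht
          simp [hts, this]
    have := hmax _ hP
    rw [Finset.card_insert_of_notMem hanot', Finset.card_insert_of_notMem hbnot,
      Finset.card_erase_of_mem hs] at this
    have hpos := Finset.card_pos.2 ⟨s, hs⟩
    omega
  obtain ⟨a, -, ha⟩ := Submodule.mem_span_finset.1 hspan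
  let φ : Fin S.card ≃ S := S.equivFin.symm
  refine ⟨S.card, fun i => φ i, fun i => a (φ i), ⟨fun i => hprim _ (φ i).2, fun i j hij =>
    h2 _ (φ i).2 _ (φ j).2 fun h => hij (φ.injective (Subtype.ext h)), ?_⟩, ?_⟩
  · rw [← hsum, Equiv.sum_comp φ (fun s : S => (s : E)), Finset.sum_coe_sort S (fun s => s)]
  · rw [← ha, Equiv.sum_comp φ (fun s : S => a s • (s : E)),
      Finset.sum_coe_sort S (fun s => a s • s)]

end Spectral

/-! ### Conjugacy of primitive idempotents. -/

section Conjugation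

theorem map_one_of_mem_aut {g : E ≃ₗ[ℝ] E} (hg : g ∈ aut E) : g 1 = 1 := by
  obtain ⟨y, hy⟩ := g.surjective 1
  calc g 1 = g 1 * g y := by rw [hy, mul_one]
    _ = 1 := by rw [← hg, one_mul, hy]

theorem map_idem_of_mem_aut {g : E ≃ₗ[ℝ] E} (hg : g ∈ aut E) {c : E} (hc : c * c = c) :
    g c * g c = g c := by
  rw [← hg c c, hc]

theorem IsPrimitiveIdempotent.map {g : E ≃ₗ[ℝ] E} (hg : g ∈ aut E) {c : E}
    (hc : IsPrimitiveIdempotent c) : IsPrimitiveIdempotent (g c) := by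
  refine ⟨map_idem_of_mem_aut hg hc.1, fun h => hc.2.1 (g.map_eq_zero_iff.1 h), ?_⟩
  intro a b ha hb hab
  have hs (x : E) (hx : x * x = x) : g.symm x * g.symm x = g.symm x := by
    apply g.injective
    rw [hg, g.apply_symm_apply, hx]
  have h : c = g.symm a + g.symm b := by rw [← map_add, ← hab, g.symm_apply_apply]
  rcases hc.2.2 _ _ (hs a ha) (hs b hb) h with h | h
  · exact Or.inl (g.symm.map_eq_zero_iff.1 h)
  · exact Or.inr (g.symm.map_eq_zero_iff.1 h)

theorem IsJordanFrame.map {g : E ≃ₗ[ℝ] E} (hg : g ∈ aut E) {r : ℕ} {c : Fin r → E}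
    (hc : IsJordanFrame c) : IsJordanFrame fun i => g (c i) := by
  refine ⟨fun i => (hc.1 i).map hg, fun i j hij => ?_, ?_⟩
  · rw [← hg, hc.2.1 i j hij, map_zero]
  · rw [← map_sum, hc.2.2, map_one_of_mem_aut hg]

theorem exists_mul_self_mul_eq_one {t : ℝ} (ht : 0 < t) : ∃ q : ℝ, q * q * t = 1 := by
  refine ⟨(Real.sqrt t)⁻¹, ?_⟩
  rw [← mul_inv, Real.mul_self_sqrt ht.le, inv_mul_cancel₀ ht.ne']

/-- An element `w` of the Peirce space `E₁₂` of two orthogonal idempotents, whose square is a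
positive multiple of their sum, gives rise to an automorphism that exchanges them. -/
theorem exists_aut_swap {a u w : E} {t : ℝ} (ht : 0 < t) (hu : u * u = u) (hua : u * a = a)
    (hwa : w * a = (1 / 2 : ℝ) • w) (huw : u * w = w) (hw : w * w = t • u) :
    ∃ g ∈ aut E, g a = u - a ∧ ∀ x, w * x = 0 → u * x = 0 → g x = x := by
  -- With $q^2t=1$ the element $s=qw+(1-u)$ squares to $1$; its reflection is the required
  -- automorphism.
  obtain ⟨q, hqq⟩ := exists_mul_self_mul_eq_one ht
  have hs : (q • w + (1 - u)) * (q • w + (1 - u)) = 1 := by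
    simp only [mul_add, add_mul, mul_sub, sub_mul, smul_mul_assoc, mul_smul_comm, mul_one, one_mul,
      hu, hw, huw, mul_comm w u, smul_smul]
    rw [show q • ((q * t) • u + (w - w)) + (q • w + (1 - u) - (q • w + (u - u))) =
      (q * q * t) • u + (1 - u) by module, hqq]
    module
  obtain ⟨g, hg, hgx⟩ := exists_aut_of_sq_eq_one hs
  refine ⟨g, hg, ?_, fun x hwx hux => ?_⟩
  · rw [hgx]
    have h1 : (q • w + (1 - u)) * a = (q / 2) • w := by
      simp only [add_mul, sub_mul, smul_mul_assoc, one_mul, hua, hwa]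
      module
    have h2 : (q • w + (1 - u)) * w = (q * t) • u := by
      simp only [add_mul, sub_mul, smul_mul_assoc, one_mul, huw, hw]
      module
    rw [h1, mul_smul_comm, h2, smul_smul, smul_smul,
      show 2 * (q / 2) * (q * t) = 1 by rw [← hqq]; ring, one_smul]
  · have h1 : (q • w + (1 - u)) * x = x := by
      simp only [add_mul, sub_mul, smul_mul_assoc, one_mul, hwx, hux]
      module
    rw [hgx, h1, h1]
    module

variable [FiniteDimensional ℝ E] {B : LinearMap.BilinForm ℝ E}

/-- Linearization at $(a,a,b)$, applied to $b$, determines $(ab)^2$. Using it also with $a,b$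
exchanged will force $l=m$. -/
theorem mul_two_primitive {a b : E} {l m : ℝ} (ha : a * a = a) (hb : b * b = b)
    (h1 : a * (a * b) = (1 / 2 : ℝ) • (l • a + a * b))
    (h2 : b * (a * b) = (1 / 2 : ℝ) • (m • b + a * b)) :
    a * b * (a * b) = (1 / 4 : ℝ) • (l • a + m • b) + (m / 2) • (a * b) := by
  have h := linearized_jordan a a b b
  have e1 : a * (a * b * b) = (m / 2) • (a * b) + (1 / 4 : ℝ) • (l • a + a * b) := by
    rw [mul_comm (a * b) b, h2]
    simp only [mul_smul_comm, mul_add, h1]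
    module
  have e2 : b * (a * a * b) = (1 / 2 : ℝ) • (m • b + a * b) := by rw [ha, h2]
  rw [mul_comm b a, e1, e2, ha, hb] at h
  have h3 : a * b * (a * b) = a * b * (a * b) + (1 / 2 : ℝ) • (0 : E) := by simp
  rw [h3, ← h]
  module

/-- Two primitive idempotents that are neither orthogonal nor equal span, together with their
product, a subalgebra with unit `u`. -/
theorem IsEuclideanForm.two_primitive (hB : IsEuclideanForm B) {a b : E}
    (ha : IsPrimitiveIdempotent a) (hb : IsPrimitiveIdempotent b) (hab : a * b ≠ 0)
    (hne : a ≠ b) :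
    ∃ l : ℝ, 0 < l ∧ l < 1 ∧ a * (a * b) = (1 / 2 : ℝ) • (l • a + a * b) ∧
      b * (a * b) = (1 / 2 : ℝ) • (l • b + a * b) ∧
      a * b * (a * b) = (l / 4) • (a + b + (2 : ℝ) • (a * b)) := by
  obtain ⟨l, hl⟩ := hB.eq_smul_of_primitive ha (mul_peirceOne ha.1 b)
  obtain ⟨m, hm⟩ := hB.eq_smul_of_primitive hb (mul_peirceOne hb.1 a)
  have h1 : a * (a * b) = (1 / 2 : ℝ) • (l • a + a * b) := by
    rw [← hl, peirceOne]; module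
  have h2 : b * (a * b) = (1 / 2 : ℝ) • (m • b + a * b) := by
    rw [← hm, peirceOne, mul_comm b a]; module
  have e1 := mul_two_primitive ha.1 hb.1 h1 h2
  have e2 := mul_two_primitive hb.1 ha.1 (by rwa [mul_comm b a]) (by rwa [mul_comm b a])
  rw [mul_comm b a] at e2
  have hlm : l = m := by
    have h3 : ((m - l) / 2) • (a * b) = 0 := by
      have h4 := sub_eq_zero.2 (e2.symm.trans e1)
      rw [← neg_eq_zero, ← h4]
      module
    have := (smul_eq_zero.1 h3).resolve_right hab
    linarith
  subst hlm
  have haa : 0 < B a a := hB.pos a ha.2.1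
  have hform : B a b = l * B a a := by
    have h3 : B a (a * (a * b)) = B a b := by
      rw [← hB.assoc, ha.1, ← hB.assoc, ha.1]
    rw [h1, map_smul, map_add, map_smul, ← hB.assoc, ha.1, smul_eq_mul, smul_eq_mul] at h3
    linarith
  have hform' : B (1 - b) a = (1 - l) * B a a := by
    have h3 : B 1 a = B a a := by
      rw [hB.symm, ← ha.1, hB.assoc, mul_one, ha.1]
    rw [map_sub, LinearMap.sub_apply, h3, hB.symm b a, hform]
    ring
  have hg : (1 - b) * (1 - b) = 1 - b := by
    simp only [mul_sub, sub_mul, mul_one, one_mul, hb.1]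
    abel
  -- Positivity of $B(a,b)=l\,B(a,a)$ and $B(1-b,a)=(1-l)B(a,a)$ bounds $l$. The value $0$ would
  -- give $ab=0$; the value $1$ would put $a$ below the primitive $b$.
  refine ⟨l, ?_, ?_, h1, h2, ?_⟩
  · by_contra! h
    have h3 := hB.form_idem_nonneg ha.1 hb.1
    have h4 : B a b = 0 := le_antisymm (by rw [hform]; exact mul_nonpos_of_nonpos_of_nonneg h haa.le) h3
    exact hab (hB.mul_eq_zero_of_form_idem ha.1 hb.1 h4)
  · by_contra! h
    have h3 := hB.form_idem_nonneg hg ha.1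
    have h4 : B (1 - b) a = 0 := le_antisymm
      (by rw [hform']; exact mul_nonpos_of_nonpos_of_nonneg (by linarith) haa.le) h3
    have h5 := hB.mul_eq_zero_of_form_idem hg ha.1 h4
    rw [sub_mul, one_mul, sub_eq_zero] at h5
    have h6 : (b - a) * (b - a) = b - a := by
      simp only [mul_sub, sub_mul, ha.1, hb.1, ← h5, mul_comm a b]
      abel
    rcases hb.2.2 a (b - a) ha.1 h6 (by abel) with h | h
    · exact ha.2.1 h
    · exact hne (sub_eq_zero.1 h).symm
  · rw [e1]; module

/-- The model is symmetric $2\times2$ matrices, with $a,b$ the projections onto two lines at angle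
$\theta$ and $l=\cos^2\theta$. The unit is $u=(a+b-2ab)/(1-l)$. -/
theorem IsEuclideanForm.exists_unit_of_two_primitive (hB : IsEuclideanForm B) {a b : E}
    (ha : IsPrimitiveIdempotent a) (hb : IsPrimitiveIdempotent b) (hab : a * b ≠ 0)
    (hne : a ≠ b) :
    ∃ u : E, u * u = u ∧ u * a = a ∧ u * b = b ∧ (∀ x, a * x = 0 → b * x = 0 → u * x = 0) ∧
      IsPrimitiveIdempotent (u - a) ∧
      ∃ g ∈ aut E, g a = b ∧ ∀ x, a * x = 0 → b * x = 0 → g x = x := by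
  obtain ⟨l, hl0, hl1, h1, h2, h3⟩ := hB.two_primitive ha hb hab hne
  obtain ⟨n, hn⟩ : ∃ n : ℝ, n * (1 - l) = 1 := ⟨(1 - l)⁻¹, inv_mul_cancel₀ (by linarith)⟩
  set p := a * b with hp
  have hba : b * a = p := mul_comm b a
  have hsq : (a + b - (2 : ℝ) • p) * (a + b - (2 : ℝ) • p) =
      (1 - l) • (a + b - (2 : ℝ) • p) := by
    simp only [mul_add, add_mul, mul_sub, sub_mul, smul_mul_assoc, mul_smul_comm, ha.1, hb.1, hba,
      ← hp, mul_comm p, h1, h2, h3]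
    module
  set u := n • (a + b - (2 : ℝ) • p) with hu
  have huu : u * u = u := by
    rw [hu, smul_mul_assoc, mul_smul_comm, hsq, smul_smul n (1 - l), hn, one_smul]
  have hua : u * a = a := by
    rw [hu, mul_comm]
    simp only [mul_add, mul_sub, mul_smul_comm, ha.1, ← hp, h1]
    rw [show n • (a + p - (2 : ℝ) • (1 / 2 : ℝ) • (l • a + p)) = (n * (1 - l)) • a by module, hn,
      one_smul]
  have hub : u * b = b := by
    rw [hu, mul_comm]
    simp only [mul_add, mul_sub, mul_smul_comm, hb.1, hba, h2]
    rw [show n • (p + b - (2 : ℝ) • (1 / 2 : ℝ) • (l • b + p)) = (n * (1 - l)) • b by module, hn,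
      one_smul]
  have hup : u * p = p := by
    rw [hu]
    simp only [add_mul, sub_mul, smul_mul_assoc, h1, h2, h3]
    rw [show n • ((1 / 2 : ℝ) • (l • a + p) + (1 / 2 : ℝ) • (l • b + p) -
      (2 : ℝ) • (l / 4) • (a + b + (2 : ℝ) • p)) = (n * (1 - l)) • p by module, hn, one_smul]
  have hux : ∀ x, a * x = 0 → b * x = 0 → u * x = 0 := by
    intro x hax hbx
    have hpx : p * x = 0 := by
      have h := mul_left_comm_of_even ha.1 (z := x) (by rw [hax, mul_zero]) b
      rw [mul_comm x b, hbx, mul_zero] at h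
      rw [mul_comm]
      exact h.symm
    rw [hu, smul_mul_assoc, sub_mul, add_mul, smul_mul_assoc, hax, hbx, hpx]
    simp
  refine ⟨u, huu, hua, hub, hux, ?_, ?_⟩
  -- This $w$ is the Peirce-$1/2$ component of $b$ relative to $a$; its reflection maps $a$ to
  -- $u-a$, which is therefore primitive.
  · set w := (2 : ℝ) • (p - l • a) with hw
    have hwa : w * a = (1 / 2 : ℝ) • w := by
      rw [hw, mul_comm]
      simp only [mul_sub, mul_smul_comm, ha.1, h1]
      module
    have huw : u * w = w := by
      simp only [hw, mul_sub, mul_smul_comm, hua, hup]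
    have hww : w * w = (l * (1 - l)) • u := by
      have h : (l * (1 - l)) • u = (l * (n * (1 - l))) • (a + b - (2 : ℝ) • p) := by
        rw [hu]; module
      rw [h, hn, hw]
      simp only [mul_sub, sub_mul, smul_mul_assoc, mul_smul_comm, ha.1, mul_comm p a, h1, h3]
      module
    obtain ⟨g, hg, hga, -⟩ := exists_aut_swap (mul_pos hl0 (by linarith)) huu hua hwa huw hww
    rw [← hga]
    exact ha.map hg
  · obtain ⟨q, hq⟩ := exists_mul_self_mul_eq_one hl0
    -- In the matrix model $a+b-u$ is a multiple of the reflection in the bisector of the two lines,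
    -- so after normalization it exchanges $a$ and $b$.
    have hd : (a + b - u) * (a + b - u) = l • u := by
      have h : l • u = u - (n * (1 - l)) • (a + b - (2 : ℝ) • p) := by rw [hu]; module
      rw [h, hn]
      simp only [mul_add, add_mul, mul_sub, sub_mul, ha.1, hb.1, huu, hua, hub, mul_comm a u,
        mul_comm b u, hba, ← hp]
      module
    have hdu : (a + b - u) * u = a + b - u := by
      rw [mul_comm]
      simp only [mul_add, mul_sub, huu, hua, hub]
    have hs : (q • (a + b - u) + (1 - u)) * (q • (a + b - u) + (1 - u)) = 1 := by
      rw [add_mul, mul_add, mul_add, smul_mul_assoc, mul_smul_comm, hd, mul_comm (1 - u) (q • _),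
        smul_mul_assoc, mul_sub, hdu]
      simp only [mul_sub, sub_mul, mul_one, one_mul, huu, smul_smul]
      rw [← mul_assoc, hq]
      module
    obtain ⟨g, hg, hgx⟩ := exists_aut_of_sq_eq_one hs
    refine ⟨g, hg, ?_, fun x hax hbx => ?_⟩
    · have e1 : (q • (a + b - u) + (1 - u)) * a = q • p := by
        simp only [add_mul, sub_mul, smul_mul_assoc, one_mul, ha.1, hba, hua]
        module
      have e2 : (q • (a + b - u) + (1 - u)) * p = (q * l / 2) • (a + b) := by
        simp only [add_mul, sub_mul, smul_mul_assoc, one_mul, h1, h2, hup]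
        module
      rw [hgx, e1, mul_smul_comm, e2, smul_smul, smul_smul,
        show 2 * q * (q * l / 2) = 1 by rw [← hq]; ring]
      module
    · have e1 : (q • (a + b - u) + (1 - u)) * x = x := by
        simp only [add_mul, sub_mul, smul_mul_assoc, one_mul, hax, hbx, hux x hax hbx]
        module
      rw [hgx, e1, e1]
      module

end Conjugation

/-! ### Conjugacy and permutations of Jordan frames. -/

section Frames

theorem IsJordanFrame.mul_sum {r : ℕ} {c : Fin r → E} (hc : IsJordanFrame c) (a : Fin r → ℝ)
    (i : Fin r) : c i * ∑ j, a j • c j = a i • c i :=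
  mul_sum_smul_of_orthogonal (fun i _ => (hc.1 i).1) (fun i _ j _ => hc.2.1 i j) a
    (Finset.mem_univ i)

theorem IsJordanFrame.sum_mul_sum {r : ℕ} {c : Fin r → E} (hc : IsJordanFrame c)
    (a b : Fin r → ℝ) : (∑ j, a j • c j) * ∑ j, b j • c j = ∑ j, (a j * b j) • c j :=
  sum_smul_mul_sum_smul_of_orthogonal (fun i _ => (hc.1 i).1) (fun i _ j _ => hc.2.1 i j) a b

theorem IsJordanFrame.injective {r : ℕ} {c : Fin r → E} (hc : IsJordanFrame c) :
    Function.Injective c := by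
  intro i j hij
  by_contra hne
  have h := hc.2.1 i j hne
  rw [← hij, (hc.1 i).1] at h
  exact (hc.1 i).2.1 h

theorem IsJordanFrame.exists_mul_ne_zero {r : ℕ} {c : Fin r → E} (hc : IsJordanFrame c) {x : E}
    (hx : x ≠ 0) : ∃ i, c i * x ≠ 0 := by
  by_contra! h
  apply hx
  rw [← one_mul x, ← hc.2.2, Finset.sum_mul, Finset.sum_eq_zero fun i _ => h i]

variable [FiniteDimensional ℝ E] {B : LinearMap.BilinForm ℝ E}

/-- The $c_i$ are matched one at a time: some $g(d_l)$ is not orthogonal to $c_i$, and the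
automorphism moving it to $c_i$ fixes whatever is orthogonal to both, in particular the $c_j$
already matched. -/
theorem IsEuclideanForm.exists_aut_frame_subset (hB : IsEuclideanForm B) {r r' : ℕ}
    {c : Fin r → E} {d : Fin r' → E} (hc : IsJordanFrame c) (hd : IsJordanFrame d) :
    ∃ g ∈ aut E, ∀ i, ∃ j, g (d j) = c i := by
  suffices h : ∀ n ≤ r, ∃ g ∈ aut E, ∀ i : Fin r, i.val < n → ∃ j, g (d j) = c i by
    obtain ⟨g, hg, h⟩ := h r le_rfl
    exact ⟨g, hg, fun i => h i i.2⟩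
  intro n
  induction n with
  | zero => exact fun _ => ⟨1, one_mem _, fun i hi => absurd hi (Nat.not_lt_zero _)⟩
  | succ n ih =>
    intro hn
    obtain ⟨g, hg, h⟩ := ih (by omega)
    have hgd := hd.map hg
    set i : Fin r := ⟨n, hn⟩ with hi
    obtain ⟨l, hl⟩ := hgd.exists_mul_ne_zero (hc.1 i).2.1
    have hcases (j : Fin r) (hj : j.val < n + 1) : j.val < n ∨ j = i := by
      rcases Nat.lt_succ_iff_lt_or_eq.1 hj with h | h
      · exact Or.inl h
      · exact Or.inr (Fin.ext h)
    by_cases heq : g (d l) = c i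
    · refine ⟨g, hg, fun j hj => ?_⟩
      rcases hcases j hj with hj | rfl
      · exact h j hj
      · exact ⟨l, heq⟩
    obtain ⟨-, -, -, -, -, -, f, hf, hfi, hfix⟩ :=
      hB.exists_unit_of_two_primitive (hgd.1 l) (hc.1 i) hl heq
    refine ⟨f * g, mul_mem hf hg, fun j hj => ?_⟩
    rcases hcases j hj with hj | rfl
    · obtain ⟨m, hm⟩ := h j hj
      have hij : c i * c j = 0 := hc.2.1 i j fun h => by
        rw [← h] at hj
        exact lt_irrefl _ hj
      refine ⟨m, ?_⟩
      rw [LinearEquiv.mul_apply, hm, hfix _ _ hij]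
      rw [← hm]
      refine hgd.2.1 l m fun h => hl ?_
      rw [h]
      rw [hm, mul_comm, hij]
    · exact ⟨l, hfi⟩

theorem IsEuclideanForm.frame_card_le (hB : IsEuclideanForm B) {r r' : ℕ}
    {c : Fin r → E} {d : Fin r' → E} (hc : IsJordanFrame c) (hd : IsJordanFrame d) : r ≤ r' := by
  obtain ⟨g, -, h⟩ := hB.exists_aut_frame_subset hc hd
  choose σ hσ using h
  have hinj : Function.Injective σ := fun i j hij => hc.injective (by rw [← hσ, hij, hσ])
  simpa using Fintype.card_le_of_injective σ hinj

theorem IsEuclideanForm.exists_aut_perm_frame (hB : IsEuclideanForm B) {r : ℕ}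
    {c d : Fin r → E} (hc : IsJordanFrame c) (hd : IsJordanFrame d) :
    ∃ g ∈ aut E, ∃ σ : Equiv.Perm (Fin r), ∀ i, g (d i) = c (σ i) := by
  obtain ⟨g, hg, h⟩ := hB.exists_aut_frame_subset hc hd
  choose σ hσ using h
  have hinj : Function.Injective σ := fun i j hij => hc.injective (by rw [← hσ, hij, hσ])
  let e : Equiv.Perm (Fin r) := Equiv.ofBijective σ (Finite.injective_iff_bijective.1 hinj)
  refine ⟨g, hg, e.symm, fun i => ?_⟩
  rw [← hσ]
  congr 2
  exact (e.apply_symm_apply i).symm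

/-- Since $E_1(a)=\mathbb Ra$ and $E_1(b)=\mathbb Rb$, $w^2=la+mb$. The Jordan identity
$w(w^2y)=w^2(wy)$ at $y=a,b$ gives $lw=w^3=mw$, and $B(w^2,1)=B(w,w)>0$ gives the sign. -/
theorem half_half_sq (hB : IsEuclideanForm B) {a b w : E} (ha : IsPrimitiveIdempotent a)
    (hb : IsPrimitiveIdempotent b) (hab : a * b = 0) (haw : a * w = (1 / 2 : ℝ) • w)
    (hbw : b * w = (1 / 2 : ℝ) • w) (hw : w ≠ 0) : ∃ t : ℝ, 0 < t ∧ w * w = t • (a + b) := by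
  have hu : (a + b) * (a + b) = a + b := by
    simp only [mul_add, add_mul, ha.1, hb.1, hab, mul_comm b a]
    abel
  have huw : (a + b) * w = w := by
    rw [add_mul, haw, hbw]; module
  obtain ⟨l, hl⟩ := hB.eq_smul_of_primitive ha (half_mul_half ha.1 haw haw)
  obtain ⟨m, hm⟩ := hB.eq_smul_of_primitive hb (half_mul_half hb.1 hbw hbw)
  have hww : w * w = l • a + m • b := by
    rw [← hl, ← hm, ← add_mul, one_mul_one hu huw huw]
  have hjw (y : E) : w * (w * w * y) = w * w * (w * y) := by
    have h := IsCommJordan.lmul_comm_rmul_rmul w y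
    rw [mul_comm y (w * w)] at h
    rw [← h, mul_comm]
  have h1 : w * (w * w) = l • w := by
    have h := hjw a
    rw [mul_comm _ a, hl, mul_comm w a, haw, mul_smul_comm, mul_smul_comm, mul_comm w a, haw,
      mul_comm (w * w)] at h
    rw [show w * (w * w) = (2 : ℝ) • (1 / 2 : ℝ) • (w * (w * w)) by module, ← h]
    module
  have h2 : w * (w * w) = m • w := by
    have h := hjw b
    rw [mul_comm _ b, hm, mul_comm w b, hbw, mul_smul_comm, mul_smul_comm, mul_comm w b, hbw,
      mul_comm (w * w)] at h
    rw [show w * (w * w) = (2 : ℝ) • (1 / 2 : ℝ) • (w * (w * w)) by module, ← h]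
    module
  have hlm : l = m := smul_left_injective ℝ hw (by simpa using h1.symm.trans h2)
  subst hlm
  refine ⟨l, ?_, by rw [hww, smul_add]⟩
  have h3 : 0 < B w w := hB.pos w hw
  have h4 : B (w * w) 1 = B w w := by rw [hB.assoc, mul_one]
  have h5 : B (a + b) 1 = B (a + b) (a + b) := by rw [← hu, hB.assoc, mul_one, hu]
  rw [← h4, hww, ← smul_add, map_smul, LinearMap.smul_apply, h5, smul_eq_mul] at h3
  by_contra! h
  exact h3.not_ge (mul_nonpos_of_nonpos_of_nonneg h (hB.nonneg _))

/-- Call two indices linked if their joint Peirce-$1/2$ space is nonzero. If `j` is not linked to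
`i`, the sum $u$ of the $c_l$ over $i$ and the indices linked to it has $E_{1/2}(u)=0$, so $E_1(u)$
is a proper nonzero ideal. -/
theorem IsEuclideanForm.exists_half_half (hB : IsEuclideanForm B) (hs : IsSimpleAlg E) {r : ℕ}
    {c : Fin r → E} (hc : IsJordanFrame c) {i j : Fin r} (hij : i ≠ j) :
    ∃ w, w ≠ 0 ∧ c i * w = (1 / 2 : ℝ) • w ∧ c j * w = (1 / 2 : ℝ) • w := by
  classical
  by_contra hno
  let A : Finset (Fin r) := {l | l = i ∨
    ∃ w, w ≠ 0 ∧ c i * w = (1 / 2 : ℝ) • w ∧ c l * w = (1 / 2 : ℝ) • w}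
  have hiA : i ∈ A := by simp [A]
  have hjA : j ∉ A := by
    simp only [A, Finset.mem_filter, Finset.mem_univ, true_and, not_or]
    exact ⟨hij.symm, hno⟩
  have hdisc : ∀ l ∈ A, ∀ m ∉ A, ∀ w, c l * w = (1 / 2 : ℝ) • w → c m * w = (1 / 2 : ℝ) • w →
      w = 0 := by
    intro l hl m hm w hlw hmw
    by_contra hw
    have him : i ≠ m := by rintro rfl; exact hm hiA
    simp only [A, Finset.mem_filter, Finset.mem_univ, true_and, not_or] at hl hm
    rcases hl with rfl | ⟨z, hz, hiz, hlz⟩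
    · exact hm.2 ⟨w, hw, hlw, hmw⟩
    by_cases hil : i = l
    · rw [← hil] at hlw
      exact hm.2 ⟨w, hw, hlw, hmw⟩
    have hlm : l ≠ m := by
      rintro rfl
      exact hm.2 ⟨z, hz, hiz, hlz⟩
    have pairIdem {p q : Fin r} (hpq : p ≠ q) : (c p + c q) * (c p + c q) = c p + c q := by
      simp only [mul_add, add_mul, (hc.1 _).1, hc.2.1 p q hpq, hc.2.1 q p hpq.symm]
      abel
    have hiw : w * c i = 0 := by
      refine one_mul_zero (pairIdem hlm) (by rw [add_mul, hlw, hmw]; module) ?_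
      rw [add_mul, hc.2.1 l i (Ne.symm hil), hc.2.1 m i him.symm, add_zero]
    have hmz : z * c m = 0 := by
      refine one_mul_zero (pairIdem hil) (by rw [add_mul, hiz, hlz]; module) ?_
      rw [add_mul, hc.2.1 l m hlm, hc.2.1 i m him, add_zero]
    -- Linking is transitive: $z$ links $i,l$ and $w$ links $l,m$, so $wz$ links $i,m$. It is
    -- nonzero because $2z(zw)=z^2w$ is a positive multiple of $w$.
    refine hm.2 ⟨w * z, fun h0 => ?_, ?_, ?_⟩
    · obtain ⟨t, ht, hzz⟩ := half_half_sq hB (hc.1 i) (hc.1 l) (hc.2.1 i l hil) hiz hlz hz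
      have h := sq_mul_half (hc.1 m).1 (z := z) (by rw [mul_comm, hmz]) hmw
      rw [mul_comm z w, h0, mul_zero, smul_zero, hzz, smul_mul_assoc, add_mul, mul_comm (c i) w,
        hiw, hlw, zero_add, smul_smul] at h
      exact hw ((smul_eq_zero.1 h).resolve_left (by positivity))
    · exact even_mul_half (hc.1 i).1 (by rw [mul_comm (c i) w, hiw, mul_zero]) hiz
    · rw [mul_comm w z]
      exact even_mul_half (hc.1 m).1 (by rw [mul_comm (c m) z, hmz, mul_zero]) hmw
  set u := ∑ l ∈ A, c l with hu
  have hcu (l : Fin r) : c l * u = if l ∈ A then c l else 0 := by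
    rw [hu, Finset.mul_sum]
    split_ifs with hl
    · rw [Finset.sum_eq_single_of_mem l hl fun m _ hm => hc.2.1 l m hm.symm, (hc.1 l).1]
    · exact Finset.sum_eq_zero fun m hm => hc.2.1 l m fun h => hl (h ▸ hm)
  have huu : u * u = u := by
    nth_rewrite 1 [hu]
    rw [Finset.sum_mul, hu]
    exact Finset.sum_congr rfl fun l hl => by rw [← hu, hcu, if_pos hl]
  -- For $x\in E_{1/2}(u)$, $(1-u)(ux)=x/4$ is a sum of terms $c_m(c_lx)$ with $l\in A$, $m\notin
  -- A$, each lying in a joint Peirce-$1/2$ space that is zero.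
  have hhalf : ∀ x, u * x = (1 / 2 : ℝ) • x → x = 0 := by
    intro x hx
    have hcomm (l m : Fin r) (hlm : l ≠ m) (y : E) : c l * (c m * y) = c m * (c l * y) :=
      mul_left_comm_of_even (hc.1 l).1 (by rw [hc.2.1 l m hlm, mul_zero]) y
    have h0 : ∀ l ∈ A, ∀ m ∉ A, c m * (c l * x) = 0 := by
      intro l hl m hm
      have hlm : l ≠ m := by rintro rfl; exact hm hl
      have key (p q : Fin r) (hpq : p ≠ q) (y : E) :
          c p * (c p * (c q * y)) = (1 / 2 : ℝ) • (c p * (c q * y)) := by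
        have h1 : c q * peirceOne (c p) y = 0 := by
          rw [mul_comm]
          exact one_mul_zero (hc.1 p).1 (mul_peirceOne (hc.1 p).1 y) (hc.2.1 p q hpq)
        rw [peirceOne, mul_sub, mul_smul_comm, ← hcomm p q hpq, ← hcomm p q hpq] at h1
        rw [show c p * (c p * (c q * y)) = (1 / 2 : ℝ) • (2 : ℝ) • (c p * (c p * (c q * y))) by
          module, sub_eq_zero.1 h1]
      refine hdisc l hl m hm _ ?_ ?_
      · rw [← hcomm l m hlm]
        exact key l m hlm x
      · exact key m l hlm.symm x
    have h1 : (1 - u) * (u * x) = (1 / 4 : ℝ) • x := by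
      rw [hx, mul_smul_comm, sub_mul, hx, one_mul]; module
    have h2 : (1 - u) * (u * x) = 0 := by
      have h3 : 1 - u = ∑ m ∈ Aᶜ, c m := by
        rw [← hc.2.2, hu, sub_eq_iff_eq_add, Finset.sum_compl_add_sum]
      rw [h3, hu, Finset.sum_mul, Finset.sum_mul]
      refine Finset.sum_eq_zero fun m hm => ?_
      rw [Finset.mul_sum]
      exact Finset.sum_eq_zero fun l hl => h0 l hl m (Finset.mem_compl.1 hm)
    rw [h1] at h2
    exact (smul_eq_zero.1 h2).resolve_left (by norm_num)
  let I : Submodule ℝ E :=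
    { carrier := {x | u * x = x}
      add_mem' := fun {x y} hx hy => by
        change u * (x + y) = x + y
        rw [mul_add, hx, hy]
      zero_mem' := mul_zero u
      smul_mem' := fun t x hx => by
        change u * (t • x) = t • x
        rw [mul_smul_comm, hx] }
  have hmemI (x : E) : x ∈ I ↔ u * x = x := Iff.rfl
  have hI : ∀ x : E, ∀ y ∈ I, x * y ∈ I := by
    intro x y hy
    have hx := even_sub_peirceHalf huu x
    rw [hhalf _ (mul_peirceHalf huu x), sub_zero] at hx
    rw [hmemI, mul_left_comm_of_even huu hx, (hmemI y).1 hy]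
  rcases hs.2 I hI with h | h
  · have h1 : c i ∈ I := by rw [hmemI, mul_comm, hcu, if_pos hiA]
    rw [h] at h1
    exact (hc.1 i).2.1 h1
  · have h1 : (1 : E) ∈ I := by rw [h]; trivial
    rw [hmemI, mul_one] at h1
    have h2 := hcu j
    rw [if_neg hjA, h1, mul_one] at h2
    exact (hc.1 j).2.1 h2

theorem IsEuclideanForm.exists_aut_of_perm (hB : IsEuclideanForm B) (hs : IsSimpleAlg E) {r : ℕ}
    {c : Fin r → E} (hc : IsJordanFrame c) (σ : Equiv.Perm (Fin r)) :
    ∃ g ∈ aut E, ∀ l, g (c l) = c (σ l) := by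
  induction σ using Equiv.Perm.swap_induction_on with
  | one => exact ⟨1, one_mem _, fun l => rfl⟩
  | swap_mul σ i j hij ih =>
    obtain ⟨g, hg, h⟩ := ih
    obtain ⟨w, hw, hiw, hjw⟩ := hB.exists_half_half hs hc hij
    obtain ⟨t, ht, hww⟩ := half_half_sq hB (hc.1 i) (hc.1 j) (hc.2.1 i j hij) hiw hjw hw
    have hu : (c i + c j) * (c i + c j) = c i + c j := by
      simp only [mul_add, add_mul, (hc.1 _).1, hc.2.1 i j hij, hc.2.1 j i hij.symm]
      abel
    have huw : (c i + c j) * w = w := by rw [add_mul, hiw, hjw]; module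
    have hui : (c i + c j) * c i = c i := by
      rw [add_mul, (hc.1 i).1, hc.2.1 j i hij.symm, add_zero]
    obtain ⟨f, hf, hfi, hfix⟩ := exists_aut_swap ht hu hui (by rw [mul_comm, hiw]) huw hww
    have hfi' : f (c i) = c j := by rw [hfi]; abel
    have hfl (l : Fin r) (hli : l ≠ i) (hlj : l ≠ j) : f (c l) = c l := by
      have h0 : (c i + c j) * c l = 0 := by
        rw [add_mul, hc.2.1 i l hli.symm, hc.2.1 j l hlj.symm, add_zero]
      exact hfix _ (one_mul_zero hu huw h0) h0
    have hfj : f (c j) = c i := by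
      have h1 : f (∑ l, c l) = ∑ l, c l := by rw [hc.2.2, map_one_of_mem_aut hf]
      have h2 : ∑ l, c l = c i + c j + ∑ l ∈ (Finset.univ.erase i).erase j, c l := by
        rw [add_assoc, Finset.add_sum_erase _ _ (by simp [hij.symm]),
          Finset.add_sum_erase _ _ (Finset.mem_univ i)]
      have h3 : f (∑ l ∈ (Finset.univ.erase i).erase j, c l) =
          ∑ l ∈ (Finset.univ.erase i).erase j, c l := by
        rw [map_sum]
        refine Finset.sum_congr rfl fun l hl => ?_
        simp only [Finset.mem_erase, Finset.mem_univ, and_true] at hl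
        exact hfl l hl.2 hl.1
      rw [h2, map_add, map_add, h3, hfi', add_left_inj, add_comm, add_left_inj] at h1
      exact h1
    refine ⟨f * g, mul_mem hf hg, fun l => ?_⟩
    rw [LinearEquiv.mul_apply, h, Equiv.Perm.mul_apply]
    by_cases h1 : σ l = i
    · rw [h1, Equiv.swap_apply_left, hfi']
    by_cases h2 : σ l = j
    · rw [h2, Equiv.swap_apply_right, hfj]
    rw [Equiv.swap_apply_of_ne_of_ne h1 h2, hfl _ h1 h2]

end Frames

/-! ### The trace as an invariant of primitive idempotents. -/

section Trace

/-- The trace of the multiplication by an element. -/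
noncomputable def mulTrace : E →ₗ[ℝ] ℝ := LinearMap.trace ℝ E ∘ₗ LinearMap.mul ℝ E

theorem mulTrace_map {g : E ≃ₗ[ℝ] E} (hg : g ∈ aut E) (x : E) :
    mulTrace (g x) = mulTrace x := by
  have h : LinearMap.mul ℝ E (g x) = g.conj (LinearMap.mul ℝ E x) := by
    refine LinearMap.ext fun y => ?_
    rw [LinearEquiv.conj_apply_apply, LinearMap.mul_apply', LinearMap.mul_apply', hg,
      g.apply_symm_apply]
  rw [mulTrace, LinearMap.comp_apply, LinearMap.comp_apply, h, LinearMap.trace_conj']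

variable [FiniteDimensional ℝ E] {B : LinearMap.BilinForm ℝ E}

/-- All primitive idempotents are conjugate under $\operatorname{Aut}(E)$, and
$rt=\operatorname{tr}L(1)=\dim E>0$. -/
theorem IsEuclideanForm.exists_mulTrace_primitive (hB : IsEuclideanForm B) (hs : IsSimpleAlg E) :
    ∃ t : ℝ, 0 < t ∧ ∀ a : E, IsPrimitiveIdempotent a → mulTrace a = t := by
  have := hs.1
  obtain ⟨r, c, -, hc, -⟩ := hB.exists_jordanFrame 0
  have hr : 0 < r := by
    rcases Nat.eq_zero_or_pos r with rfl | h
    · exact absurd hc.2.2 (by simp)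
    · exact h
  have hci (i : Fin r) : mulTrace (c i) = mulTrace (c ⟨0, hr⟩) := by
    obtain ⟨g, hg, h⟩ := hB.exists_aut_of_perm hs hc (Equiv.swap i ⟨0, hr⟩)
    rw [← mulTrace_map hg, h, Equiv.swap_apply_left]
  have h1 : mulTrace (1 : E) = Module.finrank ℝ E := by
    have h : LinearMap.mul ℝ E 1 = 1 := LinearMap.ext fun y => by simp
    rw [mulTrace, LinearMap.comp_apply, h, LinearMap.trace_one]
  rw [← hc.2.2, map_sum, Finset.sum_congr rfl fun i _ => hci i] at h1
  simp only [Finset.sum_const, Finset.card_univ, Fintype.card_fin, nsmul_eq_mul] at h1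
  have h2 : (0 : ℝ) < Module.finrank ℝ E := by exact_mod_cast Module.finrank_pos
  have h3 : (0 : ℝ) < r := by exact_mod_cast hr
  refine ⟨mulTrace (c ⟨0, hr⟩), ?_, fun a ha => ?_⟩
  · rw [← h1] at h2
    exact pos_of_mul_pos_right h2 h3.le
  · obtain ⟨i, hi⟩ := hc.exists_mul_ne_zero ha.2.1
    by_cases h : c i = a
    · rw [← h, hci]
    · obtain ⟨-, -, -, -, -, -, g, hg, hga, -⟩ := hB.exists_unit_of_two_primitive (hc.1 i) ha hi h
      rw [← hga, mulTrace_map hg, hci]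

end Trace

/-! ### Uniqueness of spectral values, rank, index, invertibility. -/

section SpectralValues

open Polynomial

theorem IsJordanFrame.aeval_sum {r : ℕ} {c : Fin r → E} (hc : IsJordanFrame c) (a : Fin r → ℝ)
    (p : ℝ[X]) :
    aeval (LinearMap.mulLeft ℝ (∑ i, a i • c i)) p (1 : E) = ∑ i, p.eval (a i) • c i := by
  rw [← hc.2.2, map_sum]
  refine Finset.sum_congr rfl fun i _ => ?_
  refine Module.End.aeval_apply_of_hasEigenvector ⟨Module.End.mem_eigenspace_iff.2 ?_, (hc.1 i).2.1⟩
  rw [LinearMap.mulLeft_apply, mul_comm, hc.mul_sum]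

variable [FiniteDimensional ℝ E] {B : LinearMap.BilinForm ℝ E}

/-- The trace of $p(x)$ gives $\sum p(a_i)=\sum p(b_i)$ for every polynomial; a Lagrange polynomial
that singles out $\mu$ compares its multiplicities. -/
theorem IsEuclideanForm.spectralValues_unique (hB : IsEuclideanForm B) (hs : IsSimpleAlg E)
    {r r' : ℕ} {c : Fin r → E} {d : Fin r' → E} (hc : IsJordanFrame c) (hd : IsJordanFrame d)
    {a : Fin r → ℝ} {b : Fin r' → ℝ} (h : ∑ i, a i • c i = ∑ i, b i • d i) :
    (Finset.univ.val.map a : Multiset ℝ) = Finset.univ.val.map b := by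
  classical
  obtain ⟨t, ht, htr⟩ := hB.exists_mulTrace_primitive hs
  have hsum (p : ℝ[X]) : ∑ i, p.eval (a i) = ∑ i, p.eval (b i) := by
    have h1 := hc.aeval_sum a p
    rw [h, hd.aeval_sum b p] at h1
    have h2 := congrArg mulTrace h1
    rw [map_sum, map_sum] at h2
    simp only [map_smul, htr _ (hc.1 _), htr _ (hd.1 _), smul_eq_mul, ← Finset.sum_mul] at h2
    exact (mul_right_cancel₀ ht.ne' h2).symm
  ext μ
  let S : Finset ℝ := insert μ (Finset.univ.image a ∪ Finset.univ.image b)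
  have hev : ∀ ν ∈ S, (Lagrange.basis S id μ).eval ν = if μ = ν then 1 else 0 := by
    intro ν hν
    split_ifs with hne
    · subst hne
      exact Lagrange.eval_basis_self (v := (id : ℝ → ℝ)) Function.injective_id.injOn hν
    · exact Lagrange.eval_basis_of_ne (v := (id : ℝ → ℝ)) hne hν
  have h1 := hsum (Lagrange.basis S id μ)
  rw [Finset.sum_congr rfl fun i _ => hev (a i) (by simp [S]),
    Finset.sum_congr rfl fun i _ => hev (b i) (by simp [S]), Finset.sum_boole, Finset.sum_boole] at h1
  rw [Multiset.count_map, Multiset.count_map]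
  exact_mod_cast h1

theorem IsEuclideanForm.spectralValues_eq (hB : IsEuclideanForm B) (hs : IsSimpleAlg E)
    {r : ℕ} {c : Fin r → E} (hc : IsJordanFrame c) (a : Fin r → ℝ) :
    spectralValues (∑ i, a i • c i) = Finset.univ.val.map a := by
  have h : ∃ m, HasSpectralValues (∑ i, a i • c i) m := ⟨_, r, c, a, hc, rfl, rfl⟩
  rw [spectralValues, dif_pos h]
  obtain ⟨r', d, b, hd, hx, hm⟩ := h.choose_spec
  rw [hm]
  exact (hB.spectralValues_unique hs hc hd hx).symm

theorem IsEuclideanForm.rank_eq (hB : IsEuclideanForm B) (hs : IsSimpleAlg E)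
    {r : ℕ} {c : Fin r → E} (hc : IsJordanFrame c) (a : Fin r → ℝ) :
    rank (∑ i, a i • c i) = (Finset.univ.filter fun i => a i ≠ 0).card := by
  rw [rank, hB.spectralValues_eq hs hc, Multiset.filter_map, Multiset.card_map]
  rfl

theorem IsEuclideanForm.index_eq (hB : IsEuclideanForm B) (hs : IsSimpleAlg E)
    {r : ℕ} {c : Fin r → E} (hc : IsJordanFrame c) (a : Fin r → ℝ) :
    index (∑ i, a i • c i) = ((Finset.univ.filter fun i => 0 < a i).card : ℤ) -
      (Finset.univ.filter fun i => a i < 0).card := by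
  rw [index, hB.spectralValues_eq hs hc, Multiset.map_map, Finset.card_filter, Finset.card_filter]
  change ∑ i, (SignType.sign (a i) : ℤ) = _
  push_cast
  rw [← Finset.sum_sub_distrib]
  refine Finset.sum_congr rfl fun i _ => ?_
  rcases lt_trichotomy (a i) 0 with h | h | h
  · simp [h, h.not_gt]
  · simp [h]
  · simp [h, h.not_gt]

theorem IsJordanFrame.isInvertible_iff {r : ℕ} {c : Fin r → E} (hc : IsJordanFrame c)
    (a : Fin r → ℝ) : IsInvertible (∑ i, a i • c i) ↔ ∀ i, a i ≠ 0 := by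
  classical
  set x := ∑ i, a i • c i with hx
  constructor
  · rintro ⟨y, hy, hxy⟩ i hi
    have hy' : ∃ b : Fin r → ℝ, y = ∑ i, b i • c i := by
      clear hxy
      induction hy using NonUnitalAlgebra.adjoin_induction with
      | mem z hz =>
        rcases hz with rfl | rfl
        · exact ⟨fun _ => 1, by simp [hc.2.2]⟩
        · exact ⟨a, rfl⟩
      | add z w _ _ hz hw =>
        obtain ⟨b, rfl⟩ := hz
        obtain ⟨b', rfl⟩ := hw
        exact ⟨fun i => b i + b' i, by simp only [add_smul, Finset.sum_add_distrib]⟩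
      | zero => exact ⟨fun _ => 0, by simp⟩
      | mul z w _ _ hz hw =>
        obtain ⟨b, rfl⟩ := hz
        obtain ⟨b', rfl⟩ := hw
        exact ⟨_, hc.sum_mul_sum b b'⟩
      | smul t z _ hz =>
        obtain ⟨b, rfl⟩ := hz
        exact ⟨fun i => t * b i, by simp only [Finset.smul_sum, smul_smul]⟩
    obtain ⟨b, rfl⟩ := hy'
    rw [hx, hc.sum_mul_sum] at hxy
    have h := hc.mul_sum (fun j => a j * b j) i
    rw [hxy, mul_one, hi, zero_mul, zero_smul] at h
    exact (hc.1 i).2.1 h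
  · intro h
    have hmem (p : ℝ[X]) : aeval (LinearMap.mulLeft ℝ x) p (1 : E) ∈
        NonUnitalAlgebra.adjoin ℝ ({1, x} : Set E) := by
      have h1 : (1 : E) ∈ NonUnitalAlgebra.adjoin ℝ ({1, x} : Set E) :=
        NonUnitalAlgebra.subset_adjoin ℝ (by simp)
      have h2 : x ∈ NonUnitalAlgebra.adjoin ℝ ({1, x} : Set E) :=
        NonUnitalAlgebra.subset_adjoin ℝ (by simp)
      have hpow (n : ℕ) : (LinearMap.mulLeft ℝ x ^ n) (1 : E) ∈
          NonUnitalAlgebra.adjoin ℝ ({1, x} : Set E) := by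
        induction n with
        | zero => simpa using h1
        | succ n ih =>
          rw [pow_succ', Module.End.mul_apply, LinearMap.mulLeft_apply]
          exact mul_mem h2 ih
      induction p using Polynomial.induction_on' with
      | add p q hp hq => rw [map_add, LinearMap.add_apply]; exact add_mem hp hq
      | monomial n t =>
        rw [aeval_monomial, Module.End.mul_apply, Module.algebraMap_end_apply]
        exact SMulMemClass.smul_mem t (hpow n)
    let p : ℝ[X] := Lagrange.interpolate (Finset.univ.image a) id fun s => s⁻¹
    have hp (i : Fin r) : p.eval (a i) = (a i)⁻¹ :=
      Lagrange.eval_interpolate_at_node (v := (id : ℝ → ℝ)) (fun s => s⁻¹)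
        Function.injective_id.injOn (by simp)
    refine ⟨_, hmem p, ?_⟩
    rw [hx, hc.aeval_sum, hc.sum_mul_sum, ← hc.2.2]
    refine Finset.sum_congr rfl fun i _ => ?_
    rw [hp, mul_inv_cancel₀ (h i), one_smul]

end SpectralValues

/-! ### Self-duality of the cone and the canonical decomposition. -/

section Cone

variable [FiniteDimensional ℝ E] {B : LinearMap.BilinForm ℝ E}

theorem IsEuclideanForm.form_idem_cone_nonneg (hB : IsEuclideanForm B) {c x : E}
    (hc : c * c = c) (hx : x ∈ cone E) : 0 ≤ B c x := by
  obtain ⟨y, rfl⟩ := hx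
  exact hB.form_sq_nonneg hc y

theorem IsJordanFrame.sum_mem_cone {r : ℕ} {c : Fin r → E} (hc : IsJordanFrame c) {a : Fin r → ℝ}
    (ha : ∀ i, 0 ≤ a i) : ∑ i, a i • c i ∈ cone E := by
  refine ⟨∑ i, Real.sqrt (a i) • c i, ?_⟩
  rw [hc.sum_mul_sum]
  exact Finset.sum_congr rfl fun i _ => by rw [Real.mul_self_sqrt (ha i)]

theorem IsEuclideanForm.form_frame (hB : IsEuclideanForm B) {r : ℕ} {c : Fin r → E}
    (hc : IsJordanFrame c) (a : Fin r → ℝ) (i : Fin r) :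
    B (c i) (∑ j, a j • c j) = a i * B (c i) (c i) := by
  rw [map_sum, Finset.sum_eq_single_of_mem i (Finset.mem_univ i), map_smul, smul_eq_mul]
  intro j _ hj
  rw [map_smul, hB.form_eq_zero (hc.2.1 i j hj.symm), smul_zero]

/-- The cone of squares is self-dual; it suffices to test against idempotents. -/
theorem IsEuclideanForm.mem_cone_of_form_nonneg (hB : IsEuclideanForm B) {x : E}
    (h : ∀ c : E, c * c = c → 0 ≤ B c x) : x ∈ cone E := by
  obtain ⟨r, c, a, hc, rfl⟩ := hB.exists_jordanFrame x
  refine hc.sum_mem_cone fun i => ?_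
  have h1 := h (c i) (hc.1 i).1
  rw [hB.form_frame hc] at h1
  exact nonneg_of_mul_nonneg_left h1 (hB.pos _ (hc.1 i).2.1)

theorem IsEuclideanForm.form_cone_nonneg (hB : IsEuclideanForm B) {x y : E}
    (hx : x ∈ cone E) (hy : y ∈ cone E) : 0 ≤ B x y := by
  obtain ⟨z, rfl⟩ := hx
  obtain ⟨r, c, a, hc, rfl⟩ := hB.exists_jordanFrame z
  rw [hc.sum_mul_sum, map_sum, LinearMap.sum_apply]
  refine Finset.sum_nonneg fun i _ => ?_
  rw [map_smul, LinearMap.smul_apply, smul_eq_mul]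
  exact mul_nonneg (mul_self_nonneg _) (hB.form_idem_cone_nonneg (hc.1 i).1 hy)

theorem IsJordanFrame.isCanonicalDecomposition {r : ℕ} {c : Fin r → E} (hc : IsJordanFrame c)
    (a : Fin r → ℝ) : IsCanonicalDecomposition (∑ i, a i • c i) (∑ i, max (a i) 0 • c i)
      (∑ i, max (-a i) 0 • c i) := by
  refine ⟨hc.sum_mem_cone fun i => le_max_right _ _, hc.sum_mem_cone fun i => le_max_right _ _,
    ?_, ?_⟩
  · rw [hc.sum_mul_sum]
    refine Finset.sum_eq_zero fun i _ => ?_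
    rcases le_total (a i) 0 with h | h
    · rw [max_eq_right h, zero_mul, zero_smul]
    · rw [max_eq_right (neg_nonpos.2 h), mul_zero, zero_smul]
  · rw [← Finset.sum_sub_distrib]
    refine Finset.sum_congr rfl fun i _ => ?_
    rw [← sub_smul]
    congr 1
    rcases le_total (a i) 0 with h | h
    · rw [max_eq_right h, max_eq_left (neg_nonneg.2 h)]; ring
    · rw [max_eq_left h, max_eq_right (neg_nonpos.2 h)]; ring

/-- As $p-p'=m-m'$, its square norm is $B(p-p',m-m')=-B(p,m')-B(p',m)\le0$. -/
theorem IsEuclideanForm.canonicalDecomposition_unique (hB : IsEuclideanForm B) {v p m p' m' : E}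
    (h : IsCanonicalDecomposition v p m) (h' : IsCanonicalDecomposition v p' m') :
    p = p' ∧ m = m' := by
  obtain ⟨hp, hm, hpm, hv⟩ := h
  obtain ⟨hp', hm', hpm', hv'⟩ := h'
  have hd : p - p' = m - m' := by
    rw [sub_eq_sub_iff_sub_eq_sub, ← hv, ← hv']
  have h1 : B (p - p') (p - p') ≤ 0 := by
    nth_rewrite 2 [hd]
    simp only [map_sub, LinearMap.sub_apply, hB.form_eq_zero hpm, hB.form_eq_zero hpm']
    have h2 := hB.form_cone_nonneg hp hm'
    have h3 := hB.form_cone_nonneg hp' hm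
    linarith
  have h2 := hB.eq_zero h1
  exact ⟨sub_eq_zero.1 h2, sub_eq_zero.1 (hd ▸ h2)⟩

end Cone

/-! ### Common annihilators of primitive idempotents. -/

section Kernel

variable [FiniteDimensional ℝ E] {B : LinearMap.BilinForm ℝ E}

theorem one_sub_mul_one_sub {c : E} (hc : c * c = c) : (1 - c) * (1 - c) = 1 - c := by
  simp only [mul_sub, sub_mul, mul_one, one_mul, hc]
  abel

theorem IsEuclideanForm.exists_primitive_le (hB : IsEuclideanForm B) {e : E} (he : e * e = e)
    (he0 : e ≠ 0) : ∃ z, IsPrimitiveIdempotent z ∧ e * z = z := by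
  obtain ⟨r, c, a, hc, hx⟩ := hB.exists_jordanFrame e
  obtain ⟨i, hi⟩ := hc.exists_mul_ne_zero he0
  have h1 : c i * e = a i • c i := by rw [hx, hc.mul_sum]
  have h2 : a i ≠ 0 := fun h => hi (by rw [h1, h, zero_smul])
  have h3 : (1 - e) * c i = 0 := by
    refine hB.mul_eq_zero_of_mul_sum_eq_zero (S := Finset.univ) (fun j _ => (hc.1 j).1)
      (fun j _ k _ => hc.2.1 j k) a (one_sub_mul_one_sub he) ?_ (Finset.mem_univ i) h2
    rw [← hx, sub_mul, one_mul, he, sub_self]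
  rw [sub_mul, one_mul, sub_eq_zero] at h3
  exact ⟨c i, hc.1 i, h3.symm⟩

/-- Fewer than `r` primitive idempotents are annihilated by a common primitive idempotent. -/
theorem IsEuclideanForm.exists_primitive_annihilator (hB : IsEuclideanForm B) {t : ℝ}
    (ht : ∀ a : E, IsPrimitiveIdempotent a → mulTrace a = t) {n : ℕ} (G : Fin n → E)
    (hG : ∀ i, G i = 0 ∨ IsPrimitiveIdempotent (G i)) {e : E} (he : e * e = e)
    (heG : ∀ i, e * G i = 0) (hlt : mulTrace e + n * t < mulTrace (1 : E)) (ht0 : 0 < t) :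
    ∃ z, IsPrimitiveIdempotent z ∧ e * z = 0 ∧ ∀ i, G i * z = 0 := by
  -- This is a Gram–Schmidt process: `e` is the sum of the orthogonal idempotents produced so far,
  -- and the trace inequality says that room is left in $1-e$.
  induction n generalizing e with
  | zero =>
    have h0 : 1 - e ≠ 0 := by
      intro h
      rw [sub_eq_zero] at h
      rw [← h] at hlt
      simp at hlt
    obtain ⟨z, hz, hez⟩ := hB.exists_primitive_le (one_sub_mul_one_sub he) h0
    refine ⟨z, hz, ?_, fun i => i.elim0⟩
    rw [sub_mul, one_mul, sub_eq_self] at hez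
    exact hez
  | succ n ih =>
    push_cast at hlt
    rcases hG (Fin.last n) with hlast | hlast
    · obtain ⟨z, hz, hez, h⟩ := ih (fun i => G i.castSucc) (fun i => hG _) he (fun i => heG _)
        (by linarith)
      refine ⟨z, hz, hez, fun i => ?_⟩
      induction i using Fin.lastCases with
      | last => rw [hlast, zero_mul]
      | cast i => exact h i
    · set g := G (Fin.last n) with hg
      have heg : e * g = 0 := heG _
      -- Each remaining idempotent is replaced by one orthogonal to $e+g$ that, together with $g$,
      -- controls the same annihilator: $u-g$, with $u$ from the two-idempotent lemma. The value $0$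
      -- covers an idempotent equal to $g$.
      have hf (i : Fin n) : ∃ f : E, (f = 0 ∨ IsPrimitiveIdempotent f) ∧ (e + g) * f = 0 ∧
          ∀ z, g * z = 0 → f * z = 0 → G i.castSucc * z = 0 := by
        rcases hG i.castSucc with h0 | hp
        · exact ⟨0, Or.inl rfl, mul_zero _, fun z _ _ => by rw [h0, zero_mul]⟩
        by_cases hgi : g * G i.castSucc = 0
        · exact ⟨_, Or.inr hp, by rw [add_mul, heG, hgi, add_zero], fun z _ h => h⟩
        by_cases hne : g = G i.castSucc
        · exact ⟨0, Or.inl rfl, mul_zero _, fun z h _ => hne ▸ h⟩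
        obtain ⟨u, huu, hug, hub, hux, hprim, -⟩ :=
          hB.exists_unit_of_two_primitive hlast hp hgi hne
        refine ⟨u - g, Or.inr hprim, ?_, fun z hgz hfz => ?_⟩
        · have h1 : u * e = 0 := hux e (by rw [mul_comm, heg]) (by rw [mul_comm, heG])
          rw [add_mul, mul_sub, mul_sub, heg, hlast.1, mul_comm g u, hug, mul_comm e u, h1]
          simp
        · rw [sub_mul, hgz, sub_zero] at hfz
          exact one_mul_zero huu hub hfz
      choose f hf1 hf2 hf3 using hf
      have heg' : (e + g) * (e + g) = e + g := by
        simp only [mul_add, add_mul, he, hlast.1, heg, mul_comm g e]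
        abel
      obtain ⟨z, hz, hez, h⟩ := ih f hf1 heg' hf2 (by rw [map_add, ht g hlast]; linarith)
      have hgz : g * z = 0 := by
        have h1 : (e + g) * g = g := by rw [add_mul, heg, hlast.1, zero_add]
        exact one_mul_zero heg' h1 hez
      refine ⟨z, hz, ?_, fun i => ?_⟩
      · rwa [add_mul, hgz, add_zero] at hez
      · induction i using Fin.lastCases with
        | last => exact hgz
        | cast i => exact hf3 i z hgz (h i)

end Kernel

/-! ### Relative interiors of the cone. -/

section Interior

open Filter Topology

variable [FiniteDimensional ℝ E] {B : LinearMap.BilinForm ℝ E}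

theorem IsEuclideanForm.add_mem_cone (hB : IsEuclideanForm B) {x y : E} (hx : x ∈ cone E)
    (hy : y ∈ cone E) : x + y ∈ cone E := by
  refine hB.mem_cone_of_form_nonneg fun c hc => ?_
  rw [map_add]
  exact add_nonneg (hB.form_idem_cone_nonneg hc hx) (hB.form_idem_cone_nonneg hc hy)

theorem IsJordanFrame.mul_sum_subset {r : ℕ} {c : Fin r → E} (hc : IsJordanFrame c)
    (P : Finset (Fin r)) (a : Fin r → ℝ) :
    (∑ i ∈ P, c i) * ∑ i ∈ P, a i • c i = ∑ i ∈ P, a i • c i := by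
  have h := sum_smul_mul_sum_smul_of_orthogonal (S := P) (fun i _ => (hc.1 i).1)
    (fun i _ j _ => hc.2.1 i j) (fun _ => 1) a
  simpa using h

theorem IsJordanFrame.sum_subset_idem {r : ℕ} {c : Fin r → E} (hc : IsJordanFrame c)
    (P : Finset (Fin r)) : (∑ i ∈ P, c i) * ∑ i ∈ P, c i = ∑ i ∈ P, c i := by
  simpa using hc.mul_sum_subset P fun _ => 1

/-- A quantitative form of the fact that $e$ is interior to $C\cap E_1(e)$:
$\operatorname{tr}L(x^2)=t\sum a_j^2$ acts as a squared norm, and the bound forces $|a_j|<\delta$.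
-/
theorem IsEuclideanForm.smul_add_mem_cone (hB : IsEuclideanForm B) {t δ : ℝ}
    (ht : ∀ a : E, IsPrimitiveIdempotent a → mulTrace a = t) (ht0 : 0 < t) (hδ : 0 < δ) {e x : E}
    (he : e * e = e) (hex : e * x = x) (hx : mulTrace (x * x) < δ * δ * t) :
    δ • e + x ∈ cone E := by
  obtain ⟨r, d, a, hd, rfl⟩ := hB.exists_jordanFrame x
  rw [hd.sum_mul_sum, map_sum] at hx
  simp only [map_smul, ht _ (hd.1 _), smul_eq_mul, ← Finset.sum_mul] at hx
  have ha (j : Fin r) : -δ ≤ a j := by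
    have h1 : a j * a j ≤ ∑ i, a i * a i :=
      Finset.single_le_sum (f := fun i => a i * a i) (fun i _ => mul_self_nonneg _)
        (Finset.mem_univ j)
    have h2 : a j * a j < δ * δ := lt_of_le_of_lt h1 (lt_of_mul_lt_mul_right hx ht0.le)
    by_contra! h3
    nlinarith
  let Q : Finset (Fin r) := {j | a j ≠ 0}
  have hQ : ∀ j ∈ Q, e * d j = d j := by
    intro j hj
    have h := hB.mul_eq_zero_of_mul_sum_eq_zero (S := Finset.univ) (fun i _ => (hd.1 i).1)
      (fun i _ j _ => hd.2.1 i j) a (one_sub_mul_one_sub he)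
      (by rw [sub_mul, one_mul, hex, sub_self]) (Finset.mem_univ j) (Finset.mem_filter.1 hj).2
    rw [sub_mul, one_mul, sub_eq_zero] at h
    exact h.symm
  have hsum : ∑ j, a j • d j = ∑ j ∈ Q, a j • d j := by
    refine (Finset.sum_subset (Finset.subset_univ Q) fun j _ hj => ?_).symm
    simp only [Q, Finset.mem_filter, Finset.mem_univ, true_and, not_not] at hj
    rw [hj, zero_smul]
  set e' := ∑ j ∈ Q, d j with he'
  have hee' : e * e' = e' := by
    rw [he', Finset.mul_sum]
    exact Finset.sum_congr rfl hQ
  have hidem : (e - e') * (e - e') = e - e' := by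
    have he'' : e' * e' = e' := hd.sum_subset_idem Q
    simp only [mul_sub, sub_mul, he, hee', mul_comm e' e, he'']
    abel
  have hdec : δ • e + ∑ j, a j • d j = δ • (e - e') + ∑ j ∈ Q, (δ + a j) • d j := by
    simp only [hsum, add_smul, Finset.sum_add_distrib, ← Finset.smul_sum, ← he']
    module
  rw [hdec]
  refine hB.mem_cone_of_form_nonneg fun z hz => ?_
  rw [map_add, map_smul, map_sum]
  refine add_nonneg (mul_nonneg hδ.le (hB.form_idem_nonneg hz hidem)) (Finset.sum_nonneg ?_)
  intro j _
  rw [map_smul, smul_eq_mul]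
  exact mul_nonneg (by linarith [ha j]) (hB.form_idem_nonneg hz (hd.1 j).1)

variable [TopologicalSpace E] [IsTopologicalAddGroup E] [ContinuousSMul ℝ E] [T2Space E]

theorem mem_interiorIn {V : Submodule ℝ E} {S : Set E} {p : E} :
    p ∈ interiorIn V S ↔ p ∈ V ∧ ∀ᶠ x in 𝓝 p, x ∈ V → x ∈ S := by
  have h (q : V) : q ∈ interior (((↑) : V → E) ⁻¹' S) ↔ ∀ᶠ x in 𝓝 (q : E), x ∈ V → x ∈ S := by
    rw [mem_interior_iff_mem_nhds, nhds_subtype_eq_comap, Filter.mem_comap]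
    constructor
    · rintro ⟨U, hU, h⟩
      filter_upwards [hU] with x hx hxV
      exact h (show (⟨x, hxV⟩ : V) ∈ _ from hx)
    · intro h
      exact ⟨_, h, fun x hx => hx x.2⟩
  constructor
  · rintro ⟨q, hq, rfl⟩
    exact ⟨q.2, (h q).1 hq⟩
  · rintro ⟨hp, hS⟩
    exact ⟨⟨p, hp⟩, (h ⟨p, hp⟩).2 hS, rfl⟩

theorem neg_mem_interiorIn_neg {V : Submodule ℝ E} {S : Set E} {p : E}
    (h : p ∈ interiorIn V S) : -p ∈ interiorIn V (-S) := by
  rw [mem_interiorIn] at h ⊢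
  refine ⟨V.neg_mem h.1, ?_⟩
  have hcont : Tendsto (fun x : E => -x) (𝓝 (-p)) (𝓝 p) := by
    have := (continuous_neg (G := E)).tendsto (-p)
    rwa [neg_neg] at this
  filter_upwards [hcont.eventually h.2] with x hx hxV
  exact hx (V.neg_mem hxV)

theorem exists_add_smul_mem_of_mem_interiorIn {V : Submodule ℝ E} {S : Set E} {p z : E}
    (hp : p ∈ interiorIn V S) (hz : z ∈ V) : ∃ ε : ℝ, 0 < ε ∧ p + ε • z ∈ S := by
  rw [mem_interiorIn] at hp
  have hcont : Tendsto (fun ε : ℝ => p + ε • z) (𝓝 0) (𝓝 p) := by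
    have : Continuous fun ε : ℝ => p + ε • z := by fun_prop
    simpa using this.tendsto 0
  obtain ⟨ε, h, hε⟩ :=
    (((hcont.eventually hp.2).filter_mono nhdsWithin_le_nhds).and
      (self_mem_nhdsWithin : Set.Ioi (0 : ℝ) ∈ 𝓝[>] 0)).exists
  exact ⟨ε, hε, h (V.add_mem hp.1 (V.smul_mem _ hz))⟩

/-- For small $\varepsilon>0$ still $p-\varepsilon z\in C$, so $B(z,p)\ge\varepsilon B(z,z)>0$. -/
theorem IsEuclideanForm.form_pos_of_mem_interiorIn_cone (hB : IsEuclideanForm B)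
    {V : Submodule ℝ E} {p z : E} (hp : p ∈ interiorIn V (cone E)) (hz : z * z = z) (hz0 : z ≠ 0)
    (hzV : z ∈ V) : 0 < B z p := by
  obtain ⟨ε, hε, h⟩ := exists_add_smul_mem_of_mem_interiorIn hp (V.neg_mem hzV)
  have h1 := hB.form_idem_cone_nonneg hz h
  rw [map_add, map_smul, map_neg, smul_eq_mul] at h1
  have h2 := mul_pos hε (hB.pos z hz0)
  linarith

theorem continuous_mul_self : Continuous fun x : E => x * x := by
  let b := Module.finBasis ℝ E
  have h : (fun x : E => x * x) = fun x => ∑ i, b.coord i x • LinearMap.mulRight ℝ (b i) x := by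
    funext x
    nth_rewrite 2 [← b.sum_repr x]
    rw [Finset.mul_sum]
    exact Finset.sum_congr rfl fun i _ => by simp [mul_smul_comm]
  rw [h]
  refine continuous_finsetSum _ fun i _ => ?_
  exact ((b.coord i).continuous_of_finiteDimensional).smul
    (LinearMap.mulRight ℝ (b i)).continuous_of_finiteDimensional

theorem IsEuclideanForm.sum_mem_interiorIn_cone (hB : IsEuclideanForm B) (hs : IsSimpleAlg E)
    {r : ℕ} {c : Fin r → E} (hc : IsJordanFrame c) (P : Finset (Fin r)) {b : Fin r → ℝ}
    (hb : ∀ i ∈ P, 0 < b i) {V : Submodule ℝ E} (hV : ∀ x, x ∈ V ↔ (∑ i ∈ P, c i) * x = x) :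
    ∑ i ∈ P, b i • c i ∈ interiorIn V (cone E) := by
  obtain ⟨t, ht0, ht⟩ := hB.exists_mulTrace_primitive hs
  set e := ∑ i ∈ P, c i with he
  set p := ∑ i ∈ P, b i • c i with hp
  obtain ⟨δ, hδ, hδb⟩ : ∃ δ : ℝ, 0 < δ ∧ ∀ i ∈ P, δ ≤ b i := by
    rcases P.eq_empty_or_nonempty with rfl | hne
    · exact ⟨1, one_pos, by simp⟩
    · obtain ⟨i, hi, hmin⟩ := P.exists_min_image b hne
      exact ⟨b i, hb i hi, hmin⟩
  have hpV : p ∈ V := (hV p).2 (hc.mul_sum_subset P b)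
  rw [mem_interiorIn]
  refine ⟨hpV, ?_⟩
  have hcont : Continuous fun x : E => mulTrace ((x - p) * (x - p)) :=
    ((mulTrace (E := E)).continuous_of_finiteDimensional.comp continuous_mul_self).comp
      (continuous_id.sub continuous_const)
  have h0 : mulTrace ((p - p) * (p - p)) < δ * δ * t := by
    rw [sub_self, zero_mul, map_zero]
    positivity
  filter_upwards [hcont.continuousAt.eventually (gt_mem_nhds h0)] with x hx hxV
  have hxp := (hV _).1 (V.sub_mem hxV hpV)
  have h1 := hB.smul_add_mem_cone ht ht0 hδ (hc.sum_subset_idem P) hxp hx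
  have h2 : ∑ i ∈ P, (b i - δ) • c i ∈ cone E := by
    refine hB.mem_cone_of_form_nonneg fun z hz => ?_
    rw [map_sum]
    refine Finset.sum_nonneg fun i hi => ?_
    rw [map_smul, smul_eq_mul]
    exact mul_nonneg (by linarith [hδb i hi]) (hB.form_idem_nonneg hz (hc.1 i).1)
  have h3 := hB.add_mem_cone h2 h1
  have h4 : ∑ i ∈ P, (b i - δ) • c i + (δ • e + (x - p)) = x := by
    simp only [sub_smul, Finset.sum_sub_distrib, ← Finset.smul_sum, ← he, ← hp]
    abel
  rwa [← he, h4] at h3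

end Interior

/-! ### Signs of the spectral values of elements of the wedge. -/

section Wedge

variable [FiniteDimensional ℝ E] {B : LinearMap.BilinForm ℝ E}

theorem IsEuclideanForm.exists_primitive_mul_frame_eq_zero (hB : IsEuclideanForm B)
    (hs : IsSimpleAlg E) {r : ℕ} {c d : Fin r → E} (hc : IsJordanFrame c) (hd : IsJordanFrame d)
    {P Q : Finset (Fin r)} (hPQ : P.card + Q.card < r) :
    ∃ z, IsPrimitiveIdempotent z ∧ (∀ i ∈ P, c i * z = 0) ∧ ∀ j ∈ Q, d j * z = 0 := by
  obtain ⟨t, ht0, ht⟩ := hB.exists_mulTrace_primitive hs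
  let G : P ⊕ Q → E := Sum.elim (fun i => c i) (fun j => d j)
  let φ := (Fintype.equivFin (P ⊕ Q)).symm
  have hG (i : P ⊕ Q) : IsPrimitiveIdempotent (G i) := by
    rcases i with i | j
    · exact hc.1 i
    · exact hd.1 j
  have h1 : mulTrace (1 : E) = r * t := by
    rw [← hc.2.2, map_sum, Finset.sum_congr rfl fun i _ => ht _ (hc.1 i)]
    simp
  obtain ⟨z, hz, -, h⟩ := hB.exists_primitive_annihilator ht (fun i => G (φ i))
    (fun i => Or.inr (hG _)) (e := 0) (mul_zero 0) (fun i => zero_mul _) (by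
      rw [map_zero, zero_add, h1]
      refine mul_lt_mul_of_pos_right ?_ ht0
      rw [Fintype.card_sum, Fintype.card_coe, Fintype.card_coe]
      exact_mod_cast hPQ) ht0
  have h' (i : P ⊕ Q) : G i * z = 0 := by
    have := h (φ.symm i)
    rwa [φ.apply_symm_apply] at this
  exact ⟨z, hz, fun i hi => h' (Sum.inl ⟨i, hi⟩), fun j hj => h' (Sum.inr ⟨j, hj⟩)⟩

theorem card_filter_val_lt {r k : ℕ} (hk : k ≤ r) :
    (Finset.univ.filter fun i : Fin r => i.val < k).card = k := by
  rw [Fin.card_filter_val_lt, min_eq_right hk]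

theorem card_filter_le_val {r k : ℕ} (hk : k ≤ r) :
    (Finset.univ.filter fun i : Fin r => k ≤ i.val).card = r - k := by
  have h := Finset.card_filter_add_card_filter_not (s := (Finset.univ : Finset (Fin r)))
    (fun i => i.val < k)
  rw [card_filter_val_lt hk, Finset.card_univ, Fintype.card_fin] at h
  simp only [not_lt] at h
  omega

theorem card_pos_add_card_neg {r : ℕ} (a : Fin r → ℝ) :
    (Finset.univ.filter fun i => 0 < a i).card + (Finset.univ.filter fun i => a i < 0).card =
      (Finset.univ.filter fun i => a i ≠ 0).card := by
  classical
  rw [← Finset.card_union_of_disjoint, ← Finset.filter_or]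
  · simp only [← lt_or_lt_iff_ne, or_comm]
  · exact Finset.disjoint_filter.2 fun i _ h => h.not_gt

theorem IsJordanFrame.sum_lt_add_sum_le {r : ℕ} {c : Fin r → E} (hc : IsJordanFrame c) (k : ℕ) :
    (∑ i with i.val < k, c i) + ∑ i with k ≤ i.val, c i = 1 := by
  rw [← hc.2.2, ← Finset.sum_filter_add_sum_filter_not Finset.univ (fun i : Fin r => i.val < k)]
  simp only [not_lt]

/-- With $e=c_1+\cdots+c_k$ this is $h_k=2L(e)-\mathrm{id}$, so the eigenspaces for $1,0,-1$ are
$E_1(e)$, $E_{1/2}(e)$, $E_0(e)$. -/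
theorem IsJordanFrame.hOp_apply {r : ℕ} {c : Fin r → E} (hc : IsJordanFrame c) (k : ℕ) (x : E) :
    hOp c k x = (2 : ℝ) • ((∑ i with i.val < k, c i) * x) - x := by
  have h := hc.sum_lt_add_sum_le k
  rw [add_comm, ← eq_sub_iff_add_eq] at h
  rw [hOp, LinearMap.sub_apply, LinearMap.mulLeft_apply, LinearMap.mulLeft_apply, h, sub_mul,
    one_mul]
  module

theorem IsJordanFrame.mem_eigenspace_hOp {r : ℕ} {c : Fin r → E} (hc : IsJordanFrame c) (k : ℕ)
    (l : ℝ) (x : E) : x ∈ (hOp c k).eigenspace l ↔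
      (∑ i with i.val < k, c i) * x = ((l + 1) / 2) • x := by
  rw [Module.End.mem_eigenspace_iff, hc.hOp_apply]
  constructor
  · intro h
    rw [sub_eq_iff_eq_add] at h
    rw [show (∑ i with i.val < k, c i) * x = (1 / 2 : ℝ) • (2 : ℝ) •
      ((∑ i with i.val < k, c i) * x) by module, h]
    module
  · intro h
    rw [h]
    module

variable [TopologicalSpace E] [IsTopologicalAddGroup E] [ContinuousSMul ℝ E] [T2Space E]

theorem IsEuclideanForm.card_of_mem_wedge (hB : IsEuclideanForm B) (hs : IsSimpleAlg E) {r k : ℕ}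
    (hk : k ≤ r) {c d : Fin r → E} (hc : IsJordanFrame c) (hd : IsJordanFrame d) {a : Fin r → ℝ}
    (hv : ∑ i, a i • d i ∈ wedge (hOp c k)) :
    (Finset.univ.filter fun i => 0 < a i).card = k ∧
      (Finset.univ.filter fun i => a i < 0).card = r - k := by
  set v := ∑ i, a i • d i with hvdef
  obtain ⟨-, ⟨p, hp, m, hm, rfl⟩, w, hw, hpmw⟩ := hv
  have hsum := hc.sum_lt_add_sum_le k
  set e := ∑ i with i.val < k, c i with he
  have hpV := (hc.mem_eigenspace_hOp k _ p).1 (mem_interiorIn.1 hp).1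
  have hmV := (hc.mem_eigenspace_hOp k _ m).1 (mem_interiorIn.1 hm).1
  have hwV := (hc.mem_eigenspace_hOp k _ w).1 hw
  have hee : e * e = e := hc.sum_subset_idem _
  rw [← he] at hpV hmV hwV
  norm_num at hpV hmV hwV
  have hform (z : E) : B z v = B z p + B z m + B z w := by
    rw [← map_add, ← map_add]
    exact congrArg _ hpmw.symm
  have hzv (z : E) : B z v = ∑ j, a j * B z (d j) := by
    rw [hvdef, map_sum]
    simp
  have hle : k ≤ (Finset.univ.filter fun i => 0 < a i).card := by
    by_contra! hlt
    obtain ⟨z, hz, hz1, hz2⟩ := hB.exists_primitive_mul_frame_eq_zero hs hc hd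
      (P := {i | k ≤ i.val}) (Q := {i | 0 < a i}) (by rw [card_filter_le_val hk]; omega)
    have hez : e * z = z := by
      have h : (∑ i with k ≤ i.val, c i) * z = 0 := by
        rw [Finset.sum_mul]
        exact Finset.sum_eq_zero hz1
      rw [← add_zero (e * z), ← h, ← add_mul, hsum, one_mul]
    have h1 : 0 < B z p := hB.form_pos_of_mem_interiorIn_cone hp hz.1 hz.2.1
      ((hc.mem_eigenspace_hOp k _ z).2 (by rw [← he, hez]; norm_num))
    have h2 : B z m = 0 := hB.form_eq_zero (one_mul_zero hee hez hmV)
    -- The Peirce spaces $E_1(e)$ and $E_{1/2}(e)$ are orthogonal.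
    have h3 : B z w = 0 := by
      have h := hB.assoc e z w
      rw [hez, hwV, map_smul, smul_eq_mul] at h
      linarith
    have h4 : B z v ≤ 0 := by
      rw [hzv]
      refine Finset.sum_nonpos fun j _ => ?_
      by_cases hj : 0 < a j
      · rw [hB.symm, hB.form_eq_zero (hz2 j (by simpa using hj)), mul_zero]
      · exact mul_nonpos_of_nonpos_of_nonneg (not_lt.1 hj) (hB.form_idem_nonneg hz.1 (hd.1 j).1)
    rw [hform] at h4
    linarith
  have hle' : r - k ≤ (Finset.univ.filter fun i => a i < 0).card := by
    by_contra! hlt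
    obtain ⟨z, hz, hz1, hz2⟩ := hB.exists_primitive_mul_frame_eq_zero hs hc hd
      (P := {i | i.val < k}) (Q := {i | a i < 0}) (by rw [card_filter_val_lt hk]; omega)
    have hez : e * z = 0 := by
      rw [he, Finset.sum_mul]
      exact Finset.sum_eq_zero hz1
    have h1 : 0 < B z (-m) := by
      have hm' := neg_mem_interiorIn_neg hm
      rw [neg_neg] at hm'
      exact hB.form_pos_of_mem_interiorIn_cone hm' hz.1 hz.2.1
        ((hc.mem_eigenspace_hOp k _ z).2 (by rw [← he, hez]; norm_num))
    rw [map_neg] at h1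
    have h2 : B z p = 0 := by
      rw [hB.symm]
      exact hB.form_eq_zero (one_mul_zero hee hpV hez)
    have h3 : B z w = 0 := by
      have h := hB.assoc e z w
      rw [hez, hwV, map_smul, smul_eq_mul, map_zero, LinearMap.zero_apply] at h
      linarith
    have h4 : 0 ≤ B z v := by
      rw [hzv]
      refine Finset.sum_nonneg fun j _ => ?_
      by_cases hj : a j < 0
      · rw [hB.symm, hB.form_eq_zero (hz2 j (by simpa using hj)), mul_zero]
      · exact mul_nonneg (not_lt.1 hj) (hB.form_idem_nonneg hz.1 (hd.1 j).1)
    rw [hform] at h4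
    linarith
  -- The two lower bounds already add up to $r$, so both are equalities.
  have hadd := card_pos_add_card_neg a
  have hle'' := Finset.card_le_univ (Finset.univ.filter fun i => a i ≠ 0)
  rw [Fintype.card_fin] at hle''
  omega

end Wedge

/-! ### Orbits meeting the wedge. -/

section Orbit

variable [FiniteDimensional ℝ E] {B : LinearMap.BilinForm ℝ E}
  [TopologicalSpace E] [IsTopologicalAddGroup E] [ContinuousSMul ℝ E] [T2Space E]

theorem IsEuclideanForm.sum_mem_wedge (hB : IsEuclideanForm B) (hs : IsSimpleAlg E) {r k : ℕ}
    {c : Fin r → E} (hc : IsJordanFrame c) {b : Fin r → ℝ} (hpos : ∀ i, i.val < k → 0 < b i)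
    (hneg : ∀ i, k ≤ i.val → b i < 0) : ∑ i, b i • c i ∈ wedge (hOp c k) := by
  have hp := hB.sum_mem_interiorIn_cone hs hc {i | i.val < k} (b := b)
    (V := (hOp c k).eigenspace 1) (fun i hi => hpos i (by simpa using hi)) fun x => by
      rw [hc.mem_eigenspace_hOp]; norm_num
  have hm := neg_mem_interiorIn_neg (hB.sum_mem_interiorIn_cone hs hc {i | k ≤ i.val}
    (b := fun i => -b i) (V := (hOp c k).eigenspace (-1))
    (fun i hi => neg_pos.2 (hneg i (by simpa using hi))) fun x => by
      have h := hc.sum_lt_add_sum_le k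
      rw [← eq_sub_iff_add_eq'] at h
      rw [hc.mem_eigenspace_hOp, h, sub_mul, one_mul, sub_eq_self]
      norm_num)
  refine ⟨_, ⟨_, hp, _, hm, rfl⟩, 0, Submodule.zero_mem _, ?_⟩
  simp only [add_zero, neg_smul, Finset.sum_neg_distrib, neg_neg]
  rw [← Finset.sum_filter_add_sum_filter_not Finset.univ (fun i : Fin r => i.val < k)]
  simp only [not_lt]

theorem IsEuclideanForm.exists_aut_mem_wedge_iff (hB : IsEuclideanForm B) (hs : IsSimpleAlg E)
    {r k : ℕ} (hk : k ≤ r) {c d : Fin r → E} (hc : IsJordanFrame c) (hd : IsJordanFrame d)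
    (a : Fin r → ℝ) :
    (MulAction.orbit (aut E) (∑ i, a i • d i) ∩ wedge (hOp c k)).Nonempty ↔
      (Finset.univ.filter fun i => 0 < a i).card = k ∧
        (Finset.univ.filter fun i => a i < 0).card = r - k := by
  classical
  constructor
  · rintro ⟨_, ⟨g, rfl⟩, hg⟩
    refine hB.card_of_mem_wedge hs hk hc (hd.map g.2) (a := a) ?_
    have h : g • ∑ i, a i • d i = ∑ i, a i • g.1 (d i) := by
      change g.1 (∑ i, a i • d i) = _
      simp
    rw [← h]
    exact hg
  · rintro ⟨hpos, hneg⟩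
    obtain ⟨g, hg, σ, hσ⟩ := hB.exists_aut_perm_frame hc hd
    -- A permutation `π` taking the positive positions onto the first `k` exists because the counts
    -- agree; `f` realizes it on the frame `c` after `g` has carried `d` to `c` up to `σ`.
    have hcard : Fintype.card {i : Fin r // 0 < a i} = Fintype.card {i : Fin r // i.val < k} := by
      rw [Fintype.card_subtype, Fintype.card_subtype, hpos, card_filter_val_lt hk]
    let φ : {i : Fin r // 0 < a i} ≃ {i : Fin r // i.val < k} := Fintype.equivOfCardEq hcard
    let π : Equiv.Perm (Fin r) := φ.extendSubtype
    have hπ (i : Fin r) : (π i).val < k ↔ 0 < a i :=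
      ⟨fun h => by_contra fun h' => φ.extendSubtype_not_mem i h' h, φ.extendSubtype_mem i⟩
    have hne (i : Fin r) : a i ≠ 0 := by
      have h := card_pos_add_card_neg a
      have h' : (Finset.univ.filter fun i => a i ≠ 0) = Finset.univ := by
        rw [← Finset.card_eq_iff_eq_univ, Fintype.card_fin]
        omega
      have h'' : i ∈ Finset.univ.filter fun i => a i ≠ 0 := by rw [h']; exact Finset.mem_univ i
      exact (Finset.mem_filter.1 h'').2
    obtain ⟨f, hf, hfc⟩ := hB.exists_aut_of_perm hs hc (π * σ⁻¹)
    refine ⟨_, ⟨⟨f * g, mul_mem hf hg⟩, rfl⟩, ?_⟩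
    have h : f (g (∑ i, a i • d i)) = ∑ j, a (π.symm j) • c j := by
      rw [← Equiv.sum_comp π fun j => a (π.symm j) • c j]
      simp [hσ, hfc]
    change f (g (∑ i, a i • d i)) ∈ _
    rw [h]
    refine hB.sum_mem_wedge hs hc (fun j hj => ?_) fun j hj => ?_
    · rwa [← hπ, π.apply_symm_apply]
    · refine lt_of_le_of_ne (not_lt.1 fun h' => ?_) (hne _)
      rw [← hπ, π.apply_symm_apply] at h'
      omega

end Orbit

end JordanAlg

theorem mainTheorem8 {E : Type*} [NonAssocCommRing E] [Module ℝ E] [SMulCommClass ℝ E E]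
    [IsScalarTower ℝ E E] [IsCommJordan E] [FiniteDimensional ℝ E]
    [TopologicalSpace E] [IsTopologicalAddGroup E] [ContinuousSMul ℝ E] [T2Space E]
    (hE : JordanAlg.IsEuclidean E) (hsimple : JordanAlg.IsSimpleAlg E)
    {r : ℕ} (c : Fin r → E) (hc : JordanAlg.IsJordanFrame c) (k : ℕ) (hk : k ≤ r) :
    (∀ v : E, ∃! p : E × E, JordanAlg.IsCanonicalDecomposition v p.1 p.2) ∧
    (∀ v vp vm : E, JordanAlg.IsCanonicalDecomposition v vp vm →
      (MulAction.orbit (JordanAlg.aut E) v ⊆ (JordanAlg.wedge (JordanAlg.hOp c k))ᶜ ↔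
        JordanAlg.rank vp < k ∨ JordanAlg.rank vm < r - k) ∧
      List.TFAE [
        (MulAction.orbit (JordanAlg.aut E) v ∩ JordanAlg.wedge (JordanAlg.hOp c k)).Nonempty,
        JordanAlg.rank vp = k ∧ JordanAlg.rank vm = r - k,
        JordanAlg.IsInvertible v ∧ JordanAlg.index v = 2 * (k : ℤ) - (r : ℤ)]) ∧
    JordanAlg.wedge (JordanAlg.hOp c k) ⊆
      JordanAlg.invertibleOfIndex E (2 * (k : ℤ) - (r : ℤ)) := by
  obtain ⟨B, hsymm, hpos, hassoc⟩ := hE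
  have hB : JordanAlg.IsEuclideanForm B := ⟨hsymm, hpos, hassoc⟩
  have hframe (v : E) : ∃ (d : Fin r → E) (a : Fin r → ℝ),
      JordanAlg.IsJordanFrame d ∧ v = ∑ i, a i • d i := by
    obtain ⟨r', d, a, hd, hv⟩ := hB.exists_jordanFrame v
    obtain rfl : r' = r := le_antisymm (hB.frame_card_le hd hc) (hB.frame_card_le hc hd)
    exact ⟨d, a, hd, hv⟩
  have hinv (d : Fin r → E) (a : Fin r → ℝ) (hd : JordanAlg.IsJordanFrame d) :
      ((Finset.univ.filter fun i => 0 < a i).card = k ∧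
        (Finset.univ.filter fun i => a i < 0).card = r - k) ↔
      JordanAlg.IsInvertible (∑ i, a i • d i) ∧
        JordanAlg.index (∑ i, a i • d i) = 2 * (k : ℤ) - (r : ℤ) := by
    rw [hd.isInvertible_iff, hB.index_eq hsimple hd]
    -- The two counts have sum $r$ and difference $2k-r$ exactly when they are $k$ and $r-k$.
    have h1 := JordanAlg.card_pos_add_card_neg a
    have h2 : (∀ i, a i ≠ 0) ↔ (Finset.univ.filter fun i => a i ≠ 0).card = r := by
      simpa using (Finset.card_filter_eq_iff (s := Finset.univ) (p := fun i => a i ≠ 0)).symm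
    rw [h2]
    omega
  refine ⟨fun v => ?_, fun v vp vm hv => ?_, fun v hv => ?_⟩
  · obtain ⟨d, a, hd, rfl⟩ := hframe v
    refine ⟨(_, _), hd.isCanonicalDecomposition a, fun q hq => ?_⟩
    obtain ⟨h1, h2⟩ := hB.canonicalDecomposition_unique hq (hd.isCanonicalDecomposition a)
    exact Prod.ext h1 h2
  · obtain ⟨d, a, hd, rfl⟩ := hframe v
    obtain ⟨rfl, rfl⟩ := hB.canonicalDecomposition_unique hv (hd.isCanonicalDecomposition a)
    have hp : JordanAlg.rank (∑ i, max (a i) 0 • d i) =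
        (Finset.univ.filter fun i => 0 < a i).card := by
      rw [hB.rank_eq hsimple hd]
      simp
    have hm : JordanAlg.rank (∑ i, max (-a i) 0 • d i) =
        (Finset.univ.filter fun i => a i < 0).card := by
      rw [hB.rank_eq hsimple hd]
      simp
    have hiff := hB.exists_aut_mem_wedge_iff hsimple hk hc hd a
    rw [hp, hm]
    constructor
    -- After negation the right side says that the ranks are at least $k$ and $r-k$; their sum is at
    -- most $r$, so this is equality.
    · rw [Set.subset_compl_iff_disjoint_right, ← not_iff_not, Set.not_disjoint_iff_nonempty_inter,
        hiff]
      have h1 := JordanAlg.card_pos_add_card_neg a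
      have h2 := Finset.card_le_univ (Finset.univ.filter fun i => a i ≠ 0)
      rw [Fintype.card_fin] at h2
      omega
    · tfae_have 1 ↔ 2 := hiff
      tfae_have 2 ↔ 3 := hinv d a hd
      tfae_finish
  · obtain ⟨d, a, hd, rfl⟩ := hframe v
    exact (hinv d a hd).1 (hB.card_of_mem_wedge hsimple hk hc hd hv)
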